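/- Let $k\ge 1$ be an integer, $c=(c_1,c_2)\in\mathbb{C}^2$, $w\in\mathbb{C}$ with $w^2\neq 0,1$, and let $g_1,g_2$ be polynomials on $\mathbb{C}^2$. Fix square roots $\sqrt{1+w},\sqrt{1-w}$ and put $$A_1=\frac{1}{2\sqrt{1+w}}+\frac{1}{2i\sqrt{1-w}},\qquad A_2=\frac{1}{2\sqrt{1+w}}-\frac{1}{2i\sqrt{1-w}}.$$ Let $f,g$ be transcendental (i.e. non-polynomial) entire functions of finite order on $\mathbb{C}^2$ such that for all $z=(z_1,z_2)\in\mathbb{C}^2$ $$\left(\frac{\partial^k f}{\partial z_1^k}(z)\right)^2+2w\,\frac{\partial^k f}{\partial z_1^k}(z)\,g(z+c)+g(z+c)^2=e^{g_1(z)},\qquad \left(\frac{\partial^k g}{\partial z_1^k}(z)\right)^2+2w\,\frac{\partial^k g}{\partial z_1^k}(z)\,f(z+c)+f(z+c)^2=e^{g_2(z)},$$ and assume that $\partial^k f/\partial z_1^k$ and $\partial^k g/\partial z_1^k$ do not both vanish identically. Then at least one of the following holds. (i) There are $a_1,a_2,d_1,d_2,\xi_1,\xi_2\in\mathbb{C}$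 with $a_1,\xi_1,\xi_2\neq0$ and a polynomial $\chi$ in one variable with $\chi(z_2+c_2)=\chi(z_2)$ such that, with $\mathcal{L}(z)=a_1z_1+a_2z_2$, one has $g_1(z)=\mathcal{L}(z)+\chi(z_2)+d_1$, $g_2(z)=\mathcal{L}(z)+\chi(z_2)+d_2$, $$f(z)=\frac{A_2\xi_2+A_1\xi_2^{-1}}{\sqrt2}\,e^{\frac12[\mathcal{L}(z)+\chi(z_2)-\mathcal{L}(c)+d_2]},\qquad g(z)=\frac{A_2\xi_1+A_1\xi_1^{-1}}{\sqrt2}\,e^{\frac12[\mathcal{L}(z)+\chi(z_2)-\mathcal{L}(c)+d_1]},$$ $$e^{\mathcal{L}(c)}=\left(\frac{a_1}{2}\right)^{2k}\frac{(A_2\xi_2+A_1\xi_2^{-1})(A_2\xi_1+A_1\xi_1^{-1})}{(A_1\xi_1+A_2\xi_1^{-1})(A_1\xi_2+A_2\xi_2^{-1})},\qquad e^{\frac12[\mathcal{L}(c)+d_1-d_2]}=\left(\frac{a_1}{2}\right)^{k}\frac{A_2\xi_2+A_1\xi_2^{-1}}{A_1\xi_1+A_2\xi_1^{-1}}.$$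 If moreover $c_2\neq0$, then $\chi$ has degree at most $1$. (ii) There are $a_1,a_2,b_1,b_2,d_1,d_2,d_3,d_4\in\mathbb{C}$ and polynomials $\Phi_1,\Psi_1$ in one variable with $\Phi_1(z_2+c_2)=\Phi_1(z_2)$, $\Psi_1(z_2+c_2)=\Psi_1(z_2)$ such that, with $L_1(z)=a_1z_1+a_2z_2$, $L_2(z)=b_1z_1+b_2z_2$, the polynomials $L_1(z)+\Phi_1(z_2)$ and $L_2(z)+\Psi_1(z_2)$ do not differ by a constant (in particular they are distinct), $$g_1(z)=L_1(z)+L_2(z)+\Phi_1(z_2)+\Psi_1(z_2)+d_1+d_3,\qquad g_2(z)=L_1(z)+L_2(z)+\Phi_1(z_2)+\Psi_1(z_2)+d_2+d_4,$$ $$f(z)=\frac{A_2e^{L_2(z)+\Psi_1(z_2)-L_2(c)+d_4}+A_1e^{L_1(z)+\Phi_1(z_2)-L_1(c)+d_2}}{\sqrt2},\qquad g(z)=\frac{A_2e^{L_1(z)+\Phi_1(z_2)-L_1(c)+d_1}+A_1e^{L_2(z)+\Psi_1(z_2)-L_2(c)+d_3}}{\sqrt2},$$ and one of the following holds: (a)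 $e^{L_1(c)}=a_1^k$, $e^{L_2(c)}=b_1^k$, $e^{d_1-d_2}=1$, $e^{d_3-d_4}=1$; (b) $e^{L_1(c)}=a_1^k$, $e^{L_2(c)}=-b_1^k$, $e^{d_1-d_2}=1$, $e^{d_3-d_4}=-1$; (c) $e^{L_1(c)}=-a_1^k$, $e^{L_2(c)}=b_1^k$, $e^{d_1-d_2}=-1$, $e^{d_3-d_4}=1$; (d) $e^{L_1(c)}=-a_1^k$, $e^{L_2(c)}=-b_1^k$, $e^{d_1-d_2}=-1$, $e^{d_3-d_4}=-1$. (iii) There are $a_i,b_i,d_j,\Phi_1,\Psi_1,L_1,L_2$ as in (ii), with the same form of $g_1,g_2$ and with $L_1(z)+\Phi_1(z_2)$, $L_2(z)+\Psi_1(z_2)$ not differing by a constant, such that $$f(z)=\frac{A_2e^{L_1(z)+\Phi_1(z_2)-L_1(c)+d_2}+A_1e^{L_2(z)+\Psi_1(z_2)-L_2(c)+d_4}}{\sqrt2},\qquad g(z)=\frac{A_2e^{L_1(z)+\Phi_1(z_2)-L_1(c)+d_1}+A_1e^{L_2(z)+\Psi_1(z_2)-L_2(c)+d_3}}{\sqrt2},$$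 and one of the following holds: (a) $e^{L_1(c)}=A_2a_1^k/A_1$, $e^{L_2(c)}=A_1b_1^k/A_2$, $e^{d_1-d_2}=1$, $e^{d_3-d_4}=1$; (b) $e^{L_1(c)}=A_2a_1^k/A_1$, $e^{L_2(c)}=-A_1b_1^k/A_2$, $e^{d_1-d_2}=1$, $e^{d_3-d_4}=-1$; (c) $e^{L_1(c)}=-A_2a_1^k/A_1$, $e^{L_2(c)}=A_1b_1^k/A_2$, $e^{d_1-d_2}=-1$, $e^{d_3-d_4}=1$; (d) $e^{L_1(c)}=-A_2a_1^k/A_1$, $e^{L_2(c)}=-A_1b_1^k/A_2$, $e^{d_1-d_2}=-1$, $e^{d_3-d_4}=-1$. -/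

import Mathlib

open Complex

noncomputable section

namespace TrinomialSystem

/-- Points of `ℂ²`; the coordinates `z₁, z₂` are `z 0, z 1`. -/
abbrev C2 : Type := Fin 2 → ℂ

/-- The `k`-th partial derivative `∂ᵏf/∂z₁ᵏ` at the point `z`. -/
def partialZ1 (k : ℕ) (f : C2 → ℂ) (z : C2) : ℂ :=
  iteratedDeriv k (fun t : ℂ => f ![t, z 1]) (z 0)

/-- An entire function on `ℂ²` is transcendental if it is not a polynomial. -/
def IsTranscendental (f : C2 → ℂ) : Prop :=
  ¬ ∃ p : MvPolynomial (Fin 2) ℂ, ∀ z, f z = MvPolynomial.eval z p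

/-- Finite order of growth: for some real `ρ`, `|f(z)| ≤ exp(‖z‖^ρ)` as soon as `‖z‖` is large,
i.e. `limsup_{r → ∞} log log M(r, f) / log r < ∞` with `M(r, f)` the maximum of `|f|` on the ball
of radius `r`. (The property does not depend on the norm of `ℂ²`.) -/
def FiniteOrder (f : C2 → ℂ) : Prop :=
  ∃ ρ R : ℝ, ∀ z : C2, R ≤ ‖z‖ → ‖f z‖ ≤ Real.exp (‖z‖ ^ ρ)

/-- The system of two quadratic trinomial partial differential-difference equations. -/
def IsSolution (k : ℕ) (c : C2) (w : ℂ) (g₁ g₂ : MvPolynomial (Fin 2) ℂ) (f g : C2 → ℂ) : Prop :=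
  ∀ z : C2,
    partialZ1 k f z ^ 2 + 2 * w * partialZ1 k f z * g (z + c) + g (z + c) ^ 2
        = exp (MvPolynomial.eval z g₁) ∧
    partialZ1 k g z ^ 2 + 2 * w * partialZ1 k g z * f (z + c) + f (z + c) ^ 2
        = exp (MvPolynomial.eval z g₂)

/-- The linear form `a z₁ + b z₂`. -/
def linForm (a b : ℂ) (z : C2) : ℂ := a * z 0 + b * z 1

/-- The constant `A₁`, where `s` and `t` are square roots of `1 + w` and `1 - w`. -/
def coeffA₁ (s t : ℂ) : ℂ := 1 / (2 * s) + 1 / (2 * I * t)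

/-- The constant `A₂`, where `s` and `t` are square roots of `1 + w` and `1 - w`. -/
def coeffA₂ (s t : ℂ) : ℂ := 1 / (2 * s) - 1 / (2 * I * t)

/-- The positive square root of `2`, as a complex number. -/
def sqrtTwo : ℂ := ((Real.sqrt 2 : ℝ) : ℂ)

/-- `P(z₂ + c₂) = P(z₂)` identically. -/
def IsPeriodic (P : Polynomial ℂ) (c₂ : ℂ) : Prop :=
  ∀ x : ℂ, P.eval (x + c₂) = P.eval x

end TrinomialSystem

end

open TrinomialSystem

/-! The quadratic form splits as `F² + 2wFG + G² = (αF + βG)(βF + αG)` with `αβ = 1` and `α² + β² =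
2w`. The right side is zero-free, so both factors are zero-free of finite order, hence exponentials
of polynomials (`exists_exp_mvPolynomial`). Inverting gives `√2 ∂ᵏf = A₁e^p + A₂e^q` and `√2 g(z +
c) = A₂e^p + A₁e^q` with `p + q = g₁`, and likewise for `g`, `f`, with `p' + q' = g₂`.

Computing `∂ᵏf(z + c)` and `∂ᵏg(z + c)` in two ways relates `e^p, e^q` shifted by `c` to `e^{p'},
e^{q'}` with polynomial coefficients, and conversely. By Borel's theorem for polynomial exponents
(`sum_filter_modConst_eq_zero`) the terms match up to constants in the exponents. A matched
coefficient is constant, which makes its exponent linear in `z₁` (`eq_linear_of_expDeriv_eq_C`).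

If `p - q` is constant, everything is a single exponential: case (i). Otherwise each identity
matches straight (`p` with `p'`) or crossed (`p` with `q'`), and conversely. Both straight gives
(iii), both crossed gives (ii). A mixed choice makes a 4-cycle, which forces `p - q` to be constant
(`modConst_eq_of_cyclic`). In the surviving cases `linked_exponents` yields the linear forms, the
periodic parts and the relations between constants. -/

/-! ### Entire functions on ℂ²: derivatives, logarithms, polynomial growth -/

open Metric MeasureTheory in
/-- Cauchy's estimate for the Fréchet derivative of an entire function on a normed space. -/
theorem norm_fderiv_le_of_forall_ball {E : Type*} [NormedAddCommGroup E] [NormedSpace ℂ E]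
    {f : E → ℂ} (hf : Differentiable ℂ f) {x : E} {C : ℝ} (hC : 0 ≤ C)
    (h : ∀ y ∈ closedBall x 1, ‖f y‖ ≤ C) : ‖fderiv ℂ f x‖ ≤ C := by
  refine ContinuousLinearMap.opNorm_le_bound _ hC fun v => ?_
  rcases eq_or_ne v 0 with rfl | hv
  · simp
  have hv' : 0 < ‖v‖ := norm_pos_iff.2 hv
  have hd : Differentiable ℂ (fun t : ℂ => f (x + t • v)) := by fun_prop
  have h1 : HasDerivAt (fun t : ℂ => f (x + t • v)) (fderiv ℂ f x v) 0 := by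
    have h2 : HasDerivAt (fun t : ℂ => x + t • v) v 0 := by
      simpa using ((hasDerivAt_id (0 : ℂ)).smul_const v).const_add x
    have h3 : HasFDerivAt f (fderiv ℂ f x) (x + (0 : ℂ) • v) := by
      simpa using (hf x).hasFDerivAt
    exact h3.comp_hasDerivAt 0 h2
  rw [← h1.deriv]
  -- On the circle of radius `‖v‖⁻¹` the point `x + t • v` stays in the unit ball, and Cauchy's
  -- estimate returns the factor `‖v‖`.
  have := norm_deriv_le_of_forall_mem_sphere_norm_le (c := 0) (R := ‖v‖⁻¹) (C := C)
    (inv_pos.2 hv') hd.diffContOnCl (fun t ht => h _ (by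
      have ht' : ‖t‖ = ‖v‖⁻¹ := by simpa using ht
      simp [norm_smul, ht', hv'.ne']))
  simpa [div_inv_eq_mul] using this

open Metric MeasureTheory in
/-- Directional derivatives of entire functions are entire. -/
theorem differentiable_lineDeriv_apply {f : C2 → ℂ} (hf : Differentiable ℂ f) (v : C2) :
    Differentiable ℂ (fun z => deriv (fun t : ℂ => f (z + t • v)) 0) := by
  have hslice (z : C2) : Differentiable ℂ (fun t : ℂ => f (z + t • v)) := by fun_prop
  -- Cauchy's formula replaces the derivative by an integral of values of `f`, which can be
  -- differentiated in `z` under the integral sign.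
  have key (z : C2) : deriv (fun t : ℂ => f (z + t • v)) 0 =
      (2 * Real.pi * I : ℂ)⁻¹ • ∮ ζ in C(0, 1), ((ζ - 0) ^ 2)⁻¹ • f (z + ζ • v) :=
    (two_pi_I_inv_smul_circleIntegral_sub_sq_inv_smul_of_differentiable isOpen_univ
      (Set.subset_univ _) (hslice z).differentiableOn (by simp)).symm
  simp_rw [key]
  refine Differentiable.fun_const_smul (R := ℂ) ?_ _
  intro z₀
  -- The radius allows 1 for `z` near `z₀`, `‖v‖` for the contour, and 1 for Cauchy's estimate.
  obtain ⟨C, hC⟩ := (isCompact_closedBall z₀ (2 + ‖v‖)).exists_bound_of_continuousOn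
    hf.continuous.continuousOn
  have hC0 : 0 ≤ C := (norm_nonneg _).trans (hC z₀ (by simp; positivity))
  unfold circleIntegral
  refine (intervalIntegral.hasFDerivAt_integral_of_dominated_of_fderiv_le
    (F' := fun z θ => deriv (circleMap 0 1) θ • ((circleMap 0 1 θ - 0) ^ 2)⁻¹ •
      fderiv ℂ f (z + circleMap 0 1 θ • v))
    (bound := fun _ => C) (ball_mem_nhds z₀ one_pos) ?_ ?_ ?_ ?_ ?_ ?_).differentiableAt
  · refine Filter.Eventually.of_forall fun z => Continuous.aestronglyMeasurable ?_
    have := hf.continuous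
    simp only [deriv_circleMap, sub_zero]
    fun_prop (disch := simp [circleMap])
  · refine Continuous.intervalIntegrable ?_ _ _
    have := hf.continuous
    simp only [deriv_circleMap, sub_zero]
    fun_prop (disch := simp [circleMap])
  · have h1 : Measurable (fun θ : ℝ => fderiv ℂ f (z₀ + circleMap 0 1 θ • v)) :=
      (measurable_fderiv ℂ f).comp (by fun_prop)
    have h2 : Continuous (fun θ : ℝ => deriv (circleMap 0 1) θ) := by
      simp only [deriv_circleMap]; fun_prop
    have h3 : Continuous (fun θ : ℝ => ((circleMap 0 1 θ - 0) ^ 2)⁻¹) := by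
      fun_prop (disch := simp [circleMap])
    have := FiniteDimensional.proper ℂ (C2 →L[ℂ] ℂ)
    exact h2.aestronglyMeasurable.smul (h3.aestronglyMeasurable.smul
      h1.stronglyMeasurable.aestronglyMeasurable)
  · refine Filter.Eventually.of_forall fun θ _ z hz => ?_
    have : ‖fderiv ℂ f (z + circleMap 0 1 θ • v)‖ ≤ C := by
      refine norm_fderiv_le_of_forall_ball hf hC0 fun y hy => hC y ?_
      rw [mem_closedBall_iff_norm] at hy ⊢
      rw [mem_ball_iff_norm] at hz
      have h1 : ‖circleMap 0 1 θ • v‖ = ‖v‖ := by simp [norm_smul]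
      calc ‖y - z₀‖ = ‖(y - (z + circleMap 0 1 θ • v)) + (z - z₀) + circleMap 0 1 θ • v‖ := by
            congr 1; abel
        _ ≤ ‖y - (z + circleMap 0 1 θ • v)‖ + ‖z - z₀‖ + ‖circleMap 0 1 θ • v‖ := norm_add₃_le
        _ ≤ 2 + ‖v‖ := by rw [h1]; linarith
    simpa [norm_smul] using this
  · exact intervalIntegrable_const
  · refine Filter.Eventually.of_forall fun θ _ z hz => ?_
    refine HasFDerivAt.fun_const_smul (R := ℂ) (HasFDerivAt.fun_const_smul (R := ℂ) ?_ _) _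
    have h1 : HasFDerivAt f (fderiv ℂ f (z + circleMap 0 1 θ • v)) (z + circleMap 0 1 θ • v) :=
      (hf _).hasFDerivAt
    exact (hasFDerivAt_comp_add_right _).2 h1

/-- Since `exp` is a covering of the punctured plane and ℂ² is simply connected, `h` lifts
continuously through `exp`. Near `z₀` the lift moves by less than π, so it is a principal logarithm
of `h / h z₀` plus a constant, hence holomorphic. -/
theorem exists_log_of_ne_zero {h : C2 → ℂ} (hd : Differentiable ℂ h) (h0 : ∀ z, h z ≠ 0) :
    ∃ p : C2 → ℂ, Differentiable ℂ p ∧ ∀ z, h z = exp (p z) := by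
  obtain ⟨p, ⟨-, hp⟩, -⟩ := isCoveringMapOn_exp.existsUnique_continuousMap_lifts
    (⟨h, hd.continuous⟩ : C(C2, ℂ)) (a₀ := 0) (e₀ := log (h 0)) (by simp [exp_log (h0 0)])
    (fun a => h0 a)
  have hp' (z) : exp (p z) = h z := congrFun hp z
  refine ⟨p, fun z₀ => ?_, fun z => (hp' z).symm⟩
  have hloc : ∀ᶠ z in nhds z₀, p z = log (h z / h z₀) + p z₀ := by
    have : ∀ᶠ z in nhds z₀, ‖p z - p z₀‖ < Real.pi := by
      have : Filter.Tendsto (fun z => ‖p z - p z₀‖) (nhds z₀) (nhds 0) := by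
        have : Continuous (fun z => ‖p z - p z₀‖) := by fun_prop
        simpa using this.tendsto z₀
      exact this.eventually_lt_const Real.pi_pos
    filter_upwards [this] with z hz
    have him := (abs_im_le_norm (p z - p z₀)).trans_lt hz
    rw [abs_lt] at him
    rw [← hp', ← hp', ← exp_sub, log_exp him.1 him.2.le]
    ring
  refine DifferentiableAt.congr_of_eventuallyEq ?_ hloc
  refine DifferentiableAt.add_const _ (DifferentiableAt.clog ?_ ?_)
  · exact (hd z₀).mul_const (h z₀)⁻¹ |>.congr_of_eventuallyEq (by simp [div_eq_mul_inv])
  · simp [div_self (h0 z₀), one_mem_slitPlane]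

/-- A polynomially bounded entire function of one variable is a polynomial. -/
theorem exists_polynomial_of_growth {u : ℂ → ℂ} (hu : Differentiable ℂ u) {C : ℝ} {n : ℕ}
    (h : ∀ z, ‖u z‖ ≤ C * (1 + ‖z‖) ^ n) :
    ∃ P : Polynomial ℂ, P.natDegree ≤ n ∧ ∀ z, u z = P.eval z := by
  have hvan : ∀ m, n < m → iteratedDeriv m u 0 = 0 := by
    intro m hm
    -- Cauchy's estimate on the circle of radius `R` is of order `R^(n - m)`, at most `1 / R` up to
    -- a constant.
    have hb : ∀ R : ℝ, 1 ≤ R → ‖iteratedDeriv m u 0‖ ≤ (m.factorial * C * 2 ^ n) / R := by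
      intro R hR
      have hR0 : 0 < R := by linarith
      have hC : 0 ≤ C := by simpa using (norm_nonneg _).trans (h 0)
      have := norm_iteratedDeriv_le_of_forall_mem_sphere_norm_le (f := u) (c := 0) (R := R)
        (C := C * (2 * R) ^ n) m hR0 hu.diffContOnCl (fun z hz => by
          refine (h z).trans ?_
          have : ‖z‖ = R := by simpa using hz
          rw [this]; gcongr; linarith)
      refine this.trans ?_
      rw [div_le_div_iff₀ (by positivity) hR0]
      have : R ^ n * R ≤ R ^ m := by
        rw [← pow_succ]; exact pow_le_pow_right₀ hR hm
      calc (m.factorial : ℝ) * (C * (2 * R) ^ n) * R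
          = m.factorial * C * 2 ^ n * (R ^ n * R) := by rw [mul_pow]; ring
        _ ≤ _ := by gcongr
    have hlim : Filter.Tendsto (fun R : ℝ => (m.factorial * C * 2 ^ n) / R) Filter.atTop (nhds 0) :=
      Filter.tendsto_id.const_div_atTop _
    have := ge_of_tendsto hlim (Filter.eventually_atTop.2 ⟨1, fun R hR => hb R hR⟩)
    simpa using this
  refine ⟨∑ i ∈ Finset.range (n + 1),
    Polynomial.C ((i.factorial : ℂ)⁻¹ * iteratedDeriv i u 0) * Polynomial.X ^ i, ?_, fun z => ?_⟩
  · refine Polynomial.natDegree_sum_le_of_forall_le _ _ fun i hi => ?_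
    exact (Polynomial.natDegree_C_mul_X_pow_le _ _).trans (by simpa [Nat.lt_succ_iff] using hi)
  · rw [← taylorSeries_eq_of_entire' 0 z hu, tsum_eq_sum (s := Finset.range (n + 1))]
    · simp [Polynomial.eval_finsetSum]
    · intro i hi
      rw [hvan i (by simpa [Nat.lt_succ_iff] using hi)]; simp

/-- A polynomially bounded entire function on `ℂ²` is a polynomial. -/
theorem exists_mvPolynomial_of_growth {u : C2 → ℂ} (hu : Differentiable ℂ u) {C : ℝ} {n : ℕ}
    (h : ∀ z, ‖u z‖ ≤ C * (1 + ‖z‖) ^ n) :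
    ∃ P : MvPolynomial (Fin 2) ℂ, ∀ z, u z = MvPolynomial.eval z P := by
  have hC : 0 ≤ C := by simpa using (norm_nonneg _).trans (h 0)
  have hn (x y : ℂ) : ‖(![x, y] : C2)‖ ≤ ‖x‖ + ‖y‖ := by
    rw [pi_norm_le_iff_of_nonneg (by positivity)]
    intro i; fin_cases i <;> simp
  have hd1 (y : ℂ) : Differentiable ℂ (fun x : ℂ => u ![x, y]) :=
    hu.comp (differentiable_pi.2 fun i => by fin_cases i <;> simp)
  have hd2 (x : ℂ) : Differentiable ℂ (fun y : ℂ => u ![x, y]) :=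
    hu.comp (differentiable_pi.2 fun i => by fin_cases i <;> simp)
  have h1 (y : ℂ) : ∃ P : Polynomial ℂ, P.natDegree ≤ n ∧ ∀ x, u ![x, y] = P.eval x := by
    refine exists_polynomial_of_growth (C := C * (1 + ‖y‖) ^ n) (hd1 y) fun x => (h _).trans ?_
    rw [mul_assoc, ← mul_pow]
    gcongr
    nlinarith [hn x y, norm_nonneg x, norm_nonneg y, mul_nonneg (norm_nonneg x) (norm_nonneg y)]
  have h2 (x : ℂ) : ∃ P : Polynomial ℂ, P.natDegree ≤ n ∧ ∀ y, u ![x, y] = P.eval y := by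
    refine exists_polynomial_of_growth (C := C * (1 + ‖x‖) ^ n) (hd2 x) fun y => (h _).trans ?_
    rw [mul_assoc, ← mul_pow]
    gcongr
    nlinarith [hn x y, norm_nonneg x, norm_nonneg y, mul_nonneg (norm_nonneg x) (norm_nonneg y)]
  choose P hPd hP using h1
  choose Q hQd hQ using h2
  let v : ℕ → ℂ := fun i => (i : ℂ)
  have hv : Set.InjOn v (Finset.range (n + 1)) := fun i _ j _ hij => by simpa [v] using hij
  -- Lagrange interpolation in `z₁` at the nodes `0, …, n`: the interpolated values are the slices
  -- `u(i, z₂)`, themselves polynomials.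
  refine ⟨∑ i ∈ Finset.range (n + 1),
    Polynomial.aeval (MvPolynomial.X 1 : MvPolynomial (Fin 2) ℂ) (Q (v i)) *
      Polynomial.aeval (MvPolynomial.X 0 : MvPolynomial (Fin 2) ℂ)
        (Lagrange.basis (Finset.range (n + 1)) v i), fun z => ?_⟩
  have hz : u z = u ![z 0, z 1] := by
    congr 1; ext i; fin_cases i <;> rfl
  rw [hz, hP, Lagrange.eq_interpolate (f := P (z 1)) (s := Finset.range (n + 1)) hv
    (by
      refine lt_of_le_of_lt Polynomial.degree_le_natDegree ?_
      simp only [Finset.card_range]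
      exact_mod_cast Nat.lt_succ_of_le (hPd _))]
  have hev (j : Fin 2) (R : Polynomial ℂ) : MvPolynomial.eval z
      (Polynomial.aeval (MvPolynomial.X j : MvPolynomial (Fin 2) ℂ) R) = R.eval (z j) := by
    induction R using Polynomial.induction_on' with
    | add p q hp hq => simp [hp, hq]
    | monomial m a => simp [← Polynomial.C_mul_X_pow_eq_monomial, MvPolynomial.algebraMap_eq]
  simp only [Lagrange.interpolate_apply, Polynomial.eval_finsetSum, map_sum, map_mul,
    Polynomial.eval_mul, Polynomial.eval_C, hev, ← hP, hQ]


/-! ### Stability of finite growth -/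

/-- Growth of finite order, normalised to hold on all of `ℂ²` with an integral exponent. -/
def HasFiniteGrowth (f : C2 → ℂ) : Prop :=
  ∃ (C : ℝ) (n : ℕ), 0 ≤ C ∧ ∀ z, ‖f z‖ ≤ Real.exp (C * (1 + ‖z‖) ^ n)

theorem HasFiniteGrowth.of_finiteOrder {f : C2 → ℂ} (hc : Continuous f) (h : FiniteOrder f) :
    HasFiniteGrowth f := by
  obtain ⟨ρ, R, hρ⟩ := h
  obtain ⟨B, hB⟩ := (isCompact_closedBall (0 : C2) (max R 1)).exists_bound_of_continuousOn
    hc.continuousOn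
  -- `B` controls the compact ball through `B ≤ e^B`; the lower bound 1 serves the outside estimate.
  refine ⟨max B 1, ⌈ρ⌉₊, by positivity, fun z => ?_⟩
  have h1 : 1 ≤ (1 + ‖z‖) ^ ⌈ρ⌉₊ := one_le_pow₀ (by simp)
  rcases le_total ‖z‖ (max R 1) with hz | hz
  · calc ‖f z‖ ≤ B := hB z (by simpa using hz)
      _ ≤ max B 1 * 1 := by simp
      _ ≤ max B 1 * (1 + ‖z‖) ^ ⌈ρ⌉₊ := by gcongr
      _ ≤ _ := by linarith [Real.add_one_le_exp (max B 1 * (1 + ‖z‖) ^ ⌈ρ⌉₊)]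
  · refine (hρ z ((le_max_left _ _).trans hz)).trans (Real.exp_le_exp.2 ?_)
    have hz1 : 1 ≤ ‖z‖ := (le_max_right _ _).trans hz
    calc ‖z‖ ^ ρ ≤ ‖z‖ ^ (⌈ρ⌉₊ : ℝ) := Real.rpow_le_rpow_of_exponent_le hz1 (Nat.le_ceil ρ)
      _ = ‖z‖ ^ ⌈ρ⌉₊ := Real.rpow_natCast _ _
      _ ≤ 1 * (1 + ‖z‖) ^ ⌈ρ⌉₊ := by rw [one_mul]; gcongr; simp
      _ ≤ _ := by gcongr; exact le_max_right _ _

/-- Enlarging the ball by `r` costs only the factor `(1 + r)^n`, as `1 + ‖z‖ + r ≤ (1 + r)(1 +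
‖z‖)`. This covers both shifts and, through Cauchy's estimate, `z₁`-derivatives. -/
theorem HasFiniteGrowth.of_forall_ball {f g : C2 → ℂ} (hf : HasFiniteGrowth f) {r : ℝ} (hr : 0 ≤ r)
    (h : ∀ z C, (∀ y, ‖y‖ ≤ ‖z‖ + r → ‖f y‖ ≤ C) → ‖g z‖ ≤ C) : HasFiniteGrowth g := by
  obtain ⟨C, n, hC, hf⟩ := hf
  refine ⟨C * (1 + r) ^ n, n, by positivity, fun z => h z _ fun y hy => (hf y).trans ?_⟩
  rw [mul_assoc, ← mul_pow]
  gcongr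
  nlinarith [norm_nonneg z, norm_nonneg y, mul_nonneg hr (norm_nonneg z)]

theorem HasFiniteGrowth.comp_add_const {f : C2 → ℂ} (hf : HasFiniteGrowth f) (c : C2) :
    HasFiniteGrowth (fun z => f (z + c)) :=
  hf.of_forall_ball (norm_nonneg c) fun z _ h => h (z + c) (norm_add_le z c)

theorem HasFiniteGrowth.const_mul {f : C2 → ℂ} (hf : HasFiniteGrowth f) (a : ℂ) :
    HasFiniteGrowth (fun z => a * f z) := by
  obtain ⟨C, n, hC, hf⟩ := hf
  refine ⟨‖a‖ + C, n, by positivity, fun z => ?_⟩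
  have h1 : 1 ≤ (1 + ‖z‖) ^ n := one_le_pow₀ (by simp)
  have h2 : ‖a‖ ≤ Real.exp (‖a‖ * (1 + ‖z‖) ^ n) := by
    nlinarith [Real.add_one_le_exp (‖a‖ * (1 + ‖z‖) ^ n), norm_nonneg a]
  rw [norm_mul, add_mul, Real.exp_add]
  gcongr
  exact hf z

theorem HasFiniteGrowth.add {f g : C2 → ℂ} (hf : HasFiniteGrowth f) (hg : HasFiniteGrowth g) :
    HasFiniteGrowth (fun z => f z + g z) := by
  obtain ⟨C, n, hC, hf⟩ := hf
  obtain ⟨D, m, hD, hg⟩ := hg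
  -- The extra 1 absorbs the factor 2 coming from the two summands.
  refine ⟨C + D + 1, n + m, by positivity, fun z => ?_⟩
  have h1 : 1 ≤ (1 + ‖z‖) ^ (n + m) := one_le_pow₀ (by simp)
  have hle (j : ℕ) (hj : j ≤ n + m) : (1 + ‖z‖) ^ j ≤ (1 + ‖z‖) ^ (n + m) :=
    pow_le_pow_right₀ (by simp) hj
  have hsum : ‖f z + g z‖ ≤ 2 * Real.exp ((C + D) * (1 + ‖z‖) ^ (n + m)) := by
    rw [two_mul]
    refine (norm_add_le _ _).trans (add_le_add ((hf z).trans ?_) ((hg z).trans ?_))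
    · refine Real.exp_le_exp.2 ?_
      exact mul_le_mul (by linarith) (hle n (by omega)) (by positivity) (by positivity)
    · refine Real.exp_le_exp.2 ?_
      exact mul_le_mul (by linarith) (hle m (by omega)) (by positivity) (by positivity)
  refine hsum.trans ?_
  rw [add_mul _ 1, Real.exp_add, mul_comm]
  gcongr
  linarith [Real.add_one_le_exp (1 * (1 + ‖z‖) ^ (n + m))]

/-! ### The `z₁`-derivative, and zero-free functions of finite order -/

theorem partialZ1_one (f : C2 → ℂ) (z : C2) :
    partialZ1 1 f z = deriv (fun t : ℂ => f (z + t • ![1, 0])) 0 := by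
  have h : (fun t : ℂ => f (z + t • ![1, 0])) = fun t => (fun s : ℂ => f ![s, z 1]) (z 0 + t) := by
    ext t; congr 1; ext i; fin_cases i <;> simp
  rw [h, deriv_comp_const_add (f := fun s : ℂ => f ![s, z 1]), partialZ1, iteratedDeriv_one,
    add_zero]

theorem partialZ1_zero (f : C2 → ℂ) : partialZ1 0 f = f := by
  ext z
  simp only [partialZ1, iteratedDeriv_zero]
  congr 1; ext i; fin_cases i <;> rfl

theorem partialZ1_succ (k : ℕ) (f : C2 → ℂ) :
    partialZ1 (k + 1) f = partialZ1 k (partialZ1 1 f) := by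
  ext z
  simp only [partialZ1, iteratedDeriv_succ']
  congr 1

theorem Differentiable.partialZ1 {f : C2 → ℂ} (hf : Differentiable ℂ f) (k : ℕ) :
    Differentiable ℂ (partialZ1 k f) := by
  induction k generalizing f with
  | zero => rwa [partialZ1_zero]
  | succ k ih =>
    rw [partialZ1_succ]
    refine ih ?_
    simp_rw [funext (partialZ1_one f)]
    exact differentiable_lineDeriv_apply hf _

theorem HasFiniteGrowth.partialZ1 {f : C2 → ℂ} (hd : Differentiable ℂ f) (hf : HasFiniteGrowth f)
    (k : ℕ) : HasFiniteGrowth (partialZ1 k f) := by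
  induction k generalizing f with
  | zero => rwa [partialZ1_zero]
  | succ k ih =>
    rw [partialZ1_succ]
    refine ih (hd.partialZ1 1) (hf.of_forall_ball zero_le_one fun z C h => ?_)
    have hs : Differentiable ℂ (fun t : ℂ => f (z + t • ![1, 0])) := by fun_prop
    rw [partialZ1_one]
    refine (norm_deriv_le_of_forall_mem_sphere_norm_le one_pos hs.diffContOnCl
      (C := C) fun t ht => h _ ?_).trans (by simp)
    refine (norm_add_le _ _).trans ?_
    have h1 : ‖t‖ = 1 := by simpa using ht
    have h2 : ‖(![1, 0] : C2)‖ ≤ 1 := by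
      rw [pi_norm_le_iff_of_nonneg zero_le_one]
      intro i; fin_cases i <;> simp
    rw [norm_smul, h1, one_mul]
    gcongr

/-- A zero-free entire function of finite order on `ℂ²` is the exponential of a polynomial. -/
theorem exists_exp_mvPolynomial {h : C2 → ℂ} (hd : Differentiable ℂ h) (hg : HasFiniteGrowth h)
    (h0 : ∀ z, h z ≠ 0) :
    ∃ P : MvPolynomial (Fin 2) ℂ, ∀ z, h z = exp (MvPolynomial.eval z P) := by
  obtain ⟨p, hp, hph⟩ := exists_log_of_ne_zero hd h0
  obtain ⟨C, n, hC, hg⟩ := hg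
  have hre (z : C2) : (p z).re ≤ C * (1 + ‖z‖) ^ n := by
    have := hg z
    rwa [hph, norm_exp, Real.exp_le_exp] at this
  have hb (z : C2) : ‖p z‖ ≤ (2 * (C * 2 ^ n + 1) + ‖p 0‖ * 3) * (1 + ‖z‖) ^ n := by
    have h1 : 1 ≤ (1 + ‖z‖) ^ n := one_le_pow₀ (by simp)
    have hs : Differentiable ℂ (fun t : ℂ => p (t • z)) := by fun_prop
    -- Borel–Carathéodory on the complex line through `0` and `z`, from radius 2 to the point 1; the
    -- `+ 1` keeps the bound on the real part positive.
    have := borelCaratheodory (f := fun t : ℂ => p (t • z)) (R := 2) (z := 1)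
      (M := C * (2 * (1 + ‖z‖)) ^ n + 1) (by positivity) hs.differentiableOn (fun t ht => by
        refine (hre _).trans ?_
        have ht' : ‖t‖ ≤ 2 := by simpa using (mem_ball_zero_iff.1 ht).le
        have : C * (1 + ‖t • z‖) ^ n ≤ C * (2 * (1 + ‖z‖)) ^ n := by
          rw [norm_smul]; gcongr
          nlinarith [norm_nonneg z, mul_le_mul_of_nonneg_right ht' (norm_nonneg z)]
        linarith) two_pos (by simp)
    norm_num at this
    refine this.trans ?_
    rw [mul_pow]
    nlinarith [norm_nonneg (p 0)]
  obtain ⟨P, hP⟩ := exists_mvPolynomial_of_growth hp hb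
  exact ⟨P, fun z => by rw [hph, hP]⟩

/-! ### Borel's theorem for polynomial exponents -/

/-- Exponentials of polynomials that pairwise differ by nonconstant polynomials are linearly
independent over the polynomials (one variable). -/
theorem polynomial_exp_independent {ι : Type*} (s : Finset ι) (Q : ι → Polynomial ℂ)
    (hQ : ∀ i ∈ s, ∀ j ∈ s, i ≠ j → Polynomial.derivative (Q i - Q j) ≠ 0)
    (P : ι → Polynomial ℂ)
    (h : ∀ x : ℂ, ∑ i ∈ s, (P i).eval x * exp ((Q i).eval x) = 0) : ∀ i ∈ s, P i = 0 := by
  classical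
  induction s using Finset.induction_on generalizing P with
  | empty => simp
  | insert a s ha ih =>
    have ih' := ih (fun i hi j hj => hQ i (Finset.mem_insert_of_mem hi) j
      (Finset.mem_insert_of_mem hj))
    -- Inner induction on the number of derivatives that kill `P a`. Dividing the relation by `e^{Q
    -- a}` and differentiating turns `P a` into its derivative and `P i` into `P i' + P i (Q i - Q
    -- a)'`.
    have key : ∀ (n : ℕ) (P : ι → Polynomial ℂ),
        (∀ x : ℂ, ∑ i ∈ insert a s, (P i).eval x * exp ((Q i).eval x) = 0) →
        Polynomial.derivative^[n] (P a) = 0 → ∀ i ∈ insert a s, P i = 0 := by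
      intro n
      induction n with
      | zero =>
        intro P h hn i hi
        have hn' : P a = 0 := hn
        rcases Finset.mem_insert.1 hi with rfl | hi
        · exact hn'
        · exact ih' P (fun x => by simpa [Finset.sum_insert ha, hn'] using h x) i hi
      | succ n ihn =>
        intro P h hn
        have hzero := ihn (fun i => Polynomial.derivative (P i) +
            P i * Polynomial.derivative (Q i - Q a)) (fun x => by
          have hder : HasDerivAt (fun x => ∑ i ∈ insert a s, (P i).eval x * exp ((Q i).eval x))
              (∑ i ∈ insert a s, ((Polynomial.derivative (P i)).eval x * exp ((Q i).eval x) +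
                (P i).eval x * (exp ((Q i).eval x) * (Polynomial.derivative (Q i)).eval x))) x :=
            HasDerivAt.fun_sum fun i _ =>
              ((P i).hasDerivAt x).mul ((Q i).hasDerivAt x).cexp
          rw [funext h] at hder
          have h0 := (hasDerivAt_const x (0 : ℂ)).unique hder
          have h1 : ∑ i ∈ insert a s, (Polynomial.derivative (Q a)).eval x *
              ((P i).eval x * exp ((Q i).eval x)) = 0 := by
            rw [← Finset.mul_sum, h x, mul_zero]
          refine Eq.trans ?_ ((congrArg₂ (· - ·) h0.symm h1).trans (sub_zero 0))
          rw [← Finset.sum_sub_distrib]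
          refine Finset.sum_congr rfl fun i _ => ?_
          simp only [Polynomial.eval_add, Polynomial.eval_mul, Polynomial.derivative_sub,
            Polynomial.eval_sub]
          ring) (by simpa using hn)
        -- The new coefficient vanishes, so `P i' = -P i (Q i - Q a)'`, which has too large a degree
        -- unless `P i = 0`.
        have hs : ∀ i ∈ s, P i = 0 := by
          intro i hi
          have hz := hzero i (Finset.mem_insert_of_mem hi)
          have hne := hQ i (Finset.mem_insert_of_mem hi) a (Finset.mem_insert_self _ _)
            (fun hia => ha (hia ▸ hi))
          by_contra hP
          have h1 : Polynomial.derivative (P i) = -(P i * Polynomial.derivative (Q i - Q a)) :=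
            eq_neg_of_add_eq_zero_left hz
          have h2 := Polynomial.degree_derivative_lt hP
          rw [h1, Polynomial.degree_neg] at h2
          exact absurd h2 (not_lt.2 (Polynomial.degree_le_mul_left _ hne))
        intro i hi
        rcases Finset.mem_insert.1 hi with rfl | hi
        · refine Polynomial.funext fun x => ?_
          have := h x
          rw [Finset.sum_insert ha, Finset.sum_eq_zero (fun j hj => by simp [hs j hj])] at this
          simpa using this
        · exact hs i hi
    exact key ((P a).natDegree + 1) P h
      (Polynomial.iterate_derivative_eq_zero (Nat.lt_succ_self _))

/-- Exponentials of polynomials that pairwise differ by nonconstant polynomials are linearly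
independent over the polynomials (several variables). -/
theorem mvPolynomial_exp_independent {σ ι : Type*} (s : Finset ι) (Q : ι → MvPolynomial σ ℂ)
    (hQ : ∀ i ∈ s, ∀ j ∈ s, i ≠ j → ∀ c, Q i - Q j ≠ MvPolynomial.C c)
    (P : ι → MvPolynomial σ ℂ)
    (h : ∀ x : σ → ℂ, ∑ i ∈ s, MvPolynomial.eval x (P i) * exp (MvPolynomial.eval x (Q i)) = 0) :
    ∀ i ∈ s, P i = 0 := by
  classical
  intro i₀ hi₀
  by_contra hP
  obtain ⟨x, hx⟩ : ∃ x, MvPolynomial.eval x (P i₀) ≠ 0 := by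
    by_contra! hx
    exact hP (MvPolynomial.funext fun x => by simpa using hx x)
  -- Choose `y` so that every `Q i - Q j` takes different values at `x` and `y`; restricted to the
  -- line through them, the differences stay nonconstant and `P i₀` stays nonzero.
  obtain ⟨y, hy⟩ : ∃ y, MvPolynomial.eval y (∏ i ∈ s, ∏ j ∈ s.erase i,
      (Q i - Q j - MvPolynomial.C (MvPolynomial.eval x (Q i - Q j)))) ≠ 0 := by
    by_contra! hy
    have h0 := MvPolynomial.funext (q := 0) fun y => by rw [hy y, map_zero]
    rw [Finset.prod_eq_zero_iff] at h0
    obtain ⟨i, hi, h0⟩ := h0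
    rw [Finset.prod_eq_zero_iff] at h0
    obtain ⟨j, hj, h0⟩ := h0
    rw [Finset.mem_erase] at hj
    exact hQ i hi j hj.2 hj.1.symm _ (sub_eq_zero.1 h0)
  let l : MvPolynomial σ ℂ →ₐ[ℂ] Polynomial ℂ := MvPolynomial.aeval fun i =>
    Polynomial.C (x i) + Polynomial.C (y i - x i) * Polynomial.X
  have hl (t : ℂ) (R : MvPolynomial σ ℂ) :
      (l R).eval t = MvPolynomial.eval (fun i => x i + (y i - x i) * t) R := by
    induction R using MvPolynomial.induction_on with
    | C a => simp [l]
    | add p q hp hq => simp [hp, hq]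
    | mul_X p i hp => rw [map_mul, Polynomial.eval_mul, hp]; simp [l]
  have hl0 (R : MvPolynomial σ ℂ) : (l R).eval 0 = MvPolynomial.eval x R := by simp [hl]
  have hl1 (R : MvPolynomial σ ℂ) : (l R).eval 1 = MvPolynomial.eval y R := by simp [hl]
  have := polynomial_exp_independent s (fun i => l (Q i)) (fun i hi j hj hij hd => by
    rw [← map_sub] at hd
    have hc := Polynomial.derivative_eq_zero.1 hd
    rw [Polynomial.natDegree_eq_zero] at hc
    obtain ⟨c, hc⟩ := hc
    have h01 : MvPolynomial.eval x (Q i - Q j) = MvPolynomial.eval y (Q i - Q j) := by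
      rw [← hl0, ← hl1, ← hc]; simp
    refine hy ?_
    rw [map_prod]
    refine Finset.prod_eq_zero hi ?_
    rw [map_prod]
    refine Finset.prod_eq_zero (Finset.mem_erase.2 ⟨hij.symm, hj⟩) ?_
    rw [h01, map_sub (MvPolynomial.eval y), MvPolynomial.eval_C, sub_self]) (fun i => l (P i))
    (fun t => by simpa [hl] using h _) i₀ hi₀
  exact hx (by rw [← hl0]; simp [this])

/-- A polynomial with its constant coefficient removed: two polynomials differ by a constant iff
they have the same image. -/
noncomputable def modConst {σ : Type*} (Q : MvPolynomial σ ℂ) : MvPolynomial σ ℂ :=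
  Q - MvPolynomial.C (MvPolynomial.constantCoeff Q)

theorem modConst_eq_of_eval {σ : Type*} {Q R : MvPolynomial σ ℂ} {c : ℂ}
    (h : ∀ z, MvPolynomial.eval z Q = MvPolynomial.eval z R + c) : modConst Q = modConst R := by
  have : Q = R + MvPolynomial.C c := MvPolynomial.funext fun z => by simp [h]
  simp [modConst, this]

theorem exists_eval_eq_add_of_modConst_eq {σ : Type*} {Q R : MvPolynomial σ ℂ}
    (h : modConst Q = modConst R) :
    ∃ c, ∀ z, MvPolynomial.eval z Q = MvPolynomial.eval z R + c := by
  refine ⟨MvPolynomial.constantCoeff Q - MvPolynomial.constantCoeff R, fun z => ?_⟩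
  have := congrArg (MvPolynomial.eval z) h
  simp only [modConst, map_sub, MvPolynomial.eval_C] at this
  linear_combination this

theorem eval_modConst {σ : Type*} (Q : MvPolynomial σ ℂ) (z : σ → ℂ) :
    MvPolynomial.eval z Q =
      MvPolynomial.eval z (modConst Q) + MvPolynomial.constantCoeff Q := by
  simp [modConst]

/-- Borel's theorem for polynomial exponents: in a vanishing sum of terms `P e^Q`, the terms whose
exponents agree up to a constant already sum to zero. -/
theorem sum_filter_modConst_eq_zero {σ ι : Type*} [DecidableEq (MvPolynomial σ ℂ)] (s : Finset ι)
    (P Q : ι → MvPolynomial σ ℂ)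
    (h : ∀ x : σ → ℂ, ∑ i ∈ s, MvPolynomial.eval x (P i) * exp (MvPolynomial.eval x (Q i)) = 0)
    (R : MvPolynomial σ ℂ) (x : σ → ℂ) :
    ∑ i ∈ s with modConst (Q i) = R,
      MvPolynomial.eval x (P i) * exp (MvPolynomial.eval x (Q i)) = 0 := by
  -- Terms of one class share the exponent `R`; their constant factors go into the coefficient.
  let P' (R : MvPolynomial σ ℂ) : MvPolynomial σ ℂ := ∑ i ∈ s with modConst (Q i) = R,
    P i * MvPolynomial.C (exp (MvPolynomial.constantCoeff (Q i)))
  have hP' (R : MvPolynomial σ ℂ) (x : σ → ℂ) : MvPolynomial.eval x (P' R) *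
      exp (MvPolynomial.eval x R) = ∑ i ∈ s with modConst (Q i) = R,
        MvPolynomial.eval x (P i) * exp (MvPolynomial.eval x (Q i)) := by
    simp only [P', map_sum, Finset.sum_mul]
    refine Finset.sum_congr rfl fun i hi => ?_
    rw [eval_modConst (Q i), (Finset.mem_filter.1 hi).2, exp_add, map_mul, MvPolynomial.eval_C]
    ring
  rw [← hP']
  by_cases hR : R ∈ s.image fun i => modConst (Q i)
  · rw [mvPolynomial_exp_independent (s.image fun i => modConst (Q i)) id ?_ P' ?_ R hR]
    · simp
    · intro R₁ h₁ R₂ h₂ hne c hc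
      obtain ⟨i, -, rfl⟩ := Finset.mem_image.1 h₁
      obtain ⟨j, -, rfl⟩ := Finset.mem_image.1 h₂
      have h0 := congrArg MvPolynomial.constantCoeff hc
      simp only [id, modConst, map_sub, MvPolynomial.constantCoeff_C, sub_self] at h0
      rw [← h0, map_zero, sub_eq_zero] at hc
      exact hne hc
    · intro x
      rw [← h x, ← Finset.sum_fiberwise_of_maps_to
        (fun i hi => Finset.mem_image_of_mem (fun i => modConst (Q i)) hi)]
      exact Finset.sum_congr rfl fun R _ => hP' R x
  · have : s.filter (fun i => modConst (Q i) = R) = ∅ :=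
      Finset.filter_eq_empty_iff.2 fun i hi hi' => hR (Finset.mem_image.2 ⟨i, hi, hi'⟩)
    simp [P', this]

/-- Matching of two-term exponential sums. -/
theorem exp_pair_matching {σ : Type*} {A B : ℂ} (hA : A ≠ 0) (hB : B ≠ 0)
    {M N a b c d : MvPolynomial σ ℂ} (hab : modConst a ≠ modConst b)
    (h : ∀ x : σ → ℂ, A * exp (MvPolynomial.eval x a) + B * exp (MvPolynomial.eval x b) =
      MvPolynomial.eval x M * exp (MvPolynomial.eval x c) +
        MvPolynomial.eval x N * exp (MvPolynomial.eval x d)) :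
    modConst c ≠ modConst d ∧
    ((modConst a = modConst c ∧ modConst b = modConst d ∧
      (∀ x, A * exp (MvPolynomial.eval x a) =
        MvPolynomial.eval x M * exp (MvPolynomial.eval x c)) ∧
      (∀ x, B * exp (MvPolynomial.eval x b) =
        MvPolynomial.eval x N * exp (MvPolynomial.eval x d))) ∨
     (modConst a = modConst d ∧ modConst b = modConst c ∧
      (∀ x, A * exp (MvPolynomial.eval x a) =
        MvPolynomial.eval x N * exp (MvPolynomial.eval x d)) ∧
      (∀ x, B * exp (MvPolynomial.eval x b) =
        MvPolynomial.eval x M * exp (MvPolynomial.eval x c)))) := by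
  classical
  have key := sum_filter_modConst_eq_zero (Finset.univ : Finset (Fin 4))
    ![MvPolynomial.C A, MvPolynomial.C B, -M, -N] ![a, b, c, d] (fun x => by
      simp only [Fin.sum_univ_four]
      simp
      linear_combination h x)
  simp only [Finset.sum_filter, Fin.sum_univ_four] at key
  simp at key
  -- The terms with `a` and with `b` cannot vanish alone, so the class of each contains exactly one
  -- of `c`, `d`.
  have ha := key (modConst a)
  have hb := key (modConst b)
  simp only [if_true, hab, hab.symm, if_false] at ha hb
  by_cases hca : modConst c = modConst a <;> by_cases hda : modConst d = modConst a <;>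
    simp only [hca, hda, if_true, if_false, hab] at ha hb
  · exact absurd (hb 0) (by simp [hB])
  · by_cases hdb : modConst d = modConst b
    · simp only [hdb, if_true] at hb
      refine ⟨by rw [hca, hdb]; exact hab, Or.inl ⟨hca.symm, hdb.symm, fun x => ?_, fun x => ?_⟩⟩
      · linear_combination ha x
      · linear_combination hb x
    · simp only [hdb, if_false] at hb
      exact absurd (hb 0) (by simp [hB])
  · by_cases hcb : modConst c = modConst b
    · simp only [hcb, if_true] at hb
      refine ⟨by rw [hda, hcb]; exact hab.symm,
        Or.inr ⟨hda.symm, hcb.symm, fun x => ?_, fun x => ?_⟩⟩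
      · linear_combination ha x
      · linear_combination hb x
    · simp only [hcb, if_false] at hb
      exact absurd (hb 0) (by simp [hB])
  · exact absurd (ha 0) (by simp [hA])

/-! ### Derivatives of exponentials, and exponents linear in `z₁` -/

/-- The polynomial `R` with `∂ᵏ(P e^Q)/∂z₁ᵏ = R e^Q`. -/
noncomputable def expDeriv (Q : MvPolynomial (Fin 2) ℂ) (k : ℕ) (P : MvPolynomial (Fin 2) ℂ) :
    MvPolynomial (Fin 2) ℂ :=
  (fun P => MvPolynomial.pderiv 0 P + P * MvPolynomial.pderiv 0 Q)^[k] P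

theorem hasDerivAt_eval_pderiv (P : MvPolynomial (Fin 2) ℂ) (t y : ℂ) :
    HasDerivAt (fun t : ℂ => MvPolynomial.eval ![t, y] P)
      (MvPolynomial.eval ![t, y] (MvPolynomial.pderiv 0 P)) t := by
  induction P using MvPolynomial.induction_on with
  | C a => simpa using hasDerivAt_const t a
  | add p q hp hq => simpa using hp.fun_add hq
  | mul_X p i hp =>
    have hX : HasDerivAt (fun t : ℂ => (![t, y] : C2) i)
        (MvPolynomial.eval ![t, y] (MvPolynomial.pderiv 0 (MvPolynomial.X i))) t := by
      fin_cases i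
      · simpa using hasDerivAt_id' t
      · simpa [MvPolynomial.pderiv_X_of_ne] using hasDerivAt_const t y
    simpa [Derivation.leibniz, mul_comm, add_comm] using hp.fun_mul hX

theorem partialZ1_mul_exp_add (k : ℕ) (P₁ Q₁ P₂ Q₂ : MvPolynomial (Fin 2) ℂ) :
    partialZ1 k (fun z => MvPolynomial.eval z P₁ * exp (MvPolynomial.eval z Q₁) +
      MvPolynomial.eval z P₂ * exp (MvPolynomial.eval z Q₂)) =
    fun z => MvPolynomial.eval z (expDeriv Q₁ k P₁) * exp (MvPolynomial.eval z Q₁) +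
      MvPolynomial.eval z (expDeriv Q₂ k P₂) * exp (MvPolynomial.eval z Q₂) := by
  induction k generalizing P₁ P₂ with
  | zero => simp [partialZ1_zero, expDeriv]
  | succ k ih =>
    have h1 : partialZ1 1 (fun z => MvPolynomial.eval z P₁ * exp (MvPolynomial.eval z Q₁) +
        MvPolynomial.eval z P₂ * exp (MvPolynomial.eval z Q₂)) =
        fun z => MvPolynomial.eval z (MvPolynomial.pderiv 0 P₁ + P₁ * MvPolynomial.pderiv 0 Q₁) *
          exp (MvPolynomial.eval z Q₁) +
        MvPolynomial.eval z (MvPolynomial.pderiv 0 P₂ + P₂ * MvPolynomial.pderiv 0 Q₂) *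
          exp (MvPolynomial.eval z Q₂) := by
      ext z
      rw [partialZ1, iteratedDeriv_one]
      have hz : z = ![z 0, z 1] := by ext i; fin_cases i <;> rfl
      have := ((hasDerivAt_eval_pderiv P₁ (z 0) (z 1)).mul
        (hasDerivAt_eval_pderiv Q₁ (z 0) (z 1)).cexp).add
        ((hasDerivAt_eval_pderiv P₂ (z 0) (z 1)).mul
        (hasDerivAt_eval_pderiv Q₂ (z 0) (z 1)).cexp)
      refine this.deriv.trans ?_
      rw [← hz]
      simp only [map_add, map_mul]
      ring
    rw [partialZ1_succ, h1, ih]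
    simp [expDeriv]

theorem totalDegree_pderiv_lt {σ : Type*} (i : σ) {P : MvPolynomial σ ℂ} (h : P.totalDegree ≠ 0) :
    (MvPolynomial.pderiv i P).totalDegree < P.totalDegree := by
  classical
  rw [MvPolynomial.totalDegree, Finset.sup_lt_iff (Nat.pos_of_ne_zero h)]
  intro m hm
  rw [MvPolynomial.mem_support_iff, MvPolynomial.coeff_pderiv] at hm
  have := MvPolynomial.le_totalDegree (MvPolynomial.mem_support_iff.2 (left_ne_zero_of_mul hm))
  rw [Finsupp.sum_add_index' (by simp) (by simp)] at this
  simp at this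
  omega

/-- If `∂ᵏ(e^Q)/∂z₁ᵏ = m e^Q` with a constant `m ≠ 0`, then `Q` is linear in `z₁` with constant
leading coefficient. -/
theorem eq_linear_of_expDeriv_eq_C {Q : MvPolynomial (Fin 2) ℂ} {k : ℕ} (hk : 1 ≤ k) {m : ℂ}
    (hm : m ≠ 0) (h : expDeriv Q k 1 = MvPolynomial.C m) :
    ∃ (a : ℂ) (b : Polynomial ℂ), a ≠ 0 ∧ m = a ^ k ∧
      ∀ z, MvPolynomial.eval z Q = a * z 0 + b.eval (z 1) := by
  set d := MvPolynomial.pderiv 0 Q with hd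
  have hsucc (n : ℕ) : expDeriv Q (n + 1) 1 =
      MvPolynomial.pderiv 0 (expDeriv Q n 1) + expDeriv Q n 1 * d := by
    simp only [expDeriv, Function.iterate_succ_apply']
    rfl
  have hconst {P : MvPolynomial (Fin 2) ℂ} (hP : P.totalDegree = 0) :
      MvPolynomial.pderiv 0 P = 0 := by
    rw [MvPolynomial.totalDegree_eq_zero_iff_eq_C.1 hP, MvPolynomial.pderiv_C]
  have hd0 : d ≠ 0 := by
    intro hd0
    have : ∀ n, expDeriv Q (n + 1) 1 = 0 := by
      intro n
      induction n with
      | zero => rw [hsucc, hd0]; simp [expDeriv]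
      | succ n ih => rw [hsucc, ih]; simp
    obtain ⟨n, rfl⟩ := Nat.exists_eq_add_of_le' hk
    rw [this] at h
    exact hm (by simpa using h.symm)
  -- Multiplication by `d` dominates the `pderiv` term, which lowers the degree, so the degree grows
  -- by `d.totalDegree` at each step. A constant result with `k ≥ 1` thus forces `d` to be constant.
  have hdeg : ∀ n, expDeriv Q n 1 ≠ 0 ∧ (expDeriv Q n 1).totalDegree = n * d.totalDegree := by
    intro n
    induction n with
    | zero => simp [expDeriv]
    | succ n ih =>
      have hmul := MvPolynomial.totalDegree_mul_of_isDomain ih.1 hd0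
      have htot : (expDeriv Q (n + 1) 1).totalDegree = (expDeriv Q n 1 * d).totalDegree ∧
          expDeriv Q (n + 1) 1 ≠ 0 := by
        rw [hsucc]
        by_cases h0 : (expDeriv Q n 1).totalDegree = 0
        · rw [hconst h0, zero_add]
          exact ⟨rfl, mul_ne_zero ih.1 hd0⟩
        · have hlt := totalDegree_pderiv_lt 0 h0
          have := MvPolynomial.totalDegree_add_eq_right_of_totalDegree_lt
            (q := MvPolynomial.pderiv 0 (expDeriv Q n 1)) (p := expDeriv Q n 1 * d) (by omega)
          refine ⟨this, fun h00 => ?_⟩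
          rw [h00, MvPolynomial.totalDegree_zero] at this
          omega
      exact ⟨htot.2, by rw [htot.1, hmul, ih.2]; ring⟩
  have hdd : d.totalDegree = 0 := by
    have := (hdeg k).2
    rw [h, MvPolynomial.totalDegree_C] at this
    have hk' : k ≠ 0 := by omega
    simpa [hk'] using this.symm
  obtain ⟨a, ha⟩ : ∃ a, d = MvPolynomial.C a :=
    ⟨_, MvPolynomial.totalDegree_eq_zero_iff_eq_C.1 hdd⟩
  have ha0 : a ≠ 0 := by rintro rfl; exact hd0 (by simpa using ha)
  have hpow : ∀ n, expDeriv Q n 1 = MvPolynomial.C (a ^ n) := by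
    intro n
    induction n with
    | zero => simp [expDeriv]
    | succ n ih => rw [hsucc, ih, MvPolynomial.pderiv_C, ha, zero_add, ← map_mul, pow_succ]
  -- The polynomial in `z₂` is `Q` restricted to `z₁ = 0`.
  refine ⟨a, MvPolynomial.aeval ![0, Polynomial.X] Q, ha0, ?_, fun z => ?_⟩
  · rw [hpow] at h
    exact (MvPolynomial.C_injective _ _ h).symm
  · have hev : (MvPolynomial.aeval ![0, Polynomial.X] Q : Polynomial ℂ).eval (z 1) =
        MvPolynomial.eval ![0, z 1] Q := by
      have : ∀ R : MvPolynomial (Fin 2) ℂ,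
          (MvPolynomial.aeval ![0, Polynomial.X] R : Polynomial ℂ).eval (z 1) =
            MvPolynomial.eval ![0, z 1] R := by
        intro R
        induction R using MvPolynomial.induction_on with
        | C a => simp
        | add p q hp hq => simp [hp, hq]
        | mul_X p i hp =>
          rw [map_mul, Polynomial.eval_mul, hp, map_mul]
          fin_cases i <;> simp
      exact this Q
    have hz : z = ![z 0, z 1] := by ext i; fin_cases i <;> rfl
    have hder (t : ℂ) : HasDerivAt (fun t : ℂ => MvPolynomial.eval ![t, z 1] Q - a * t) 0 t := by
      have := (hasDerivAt_eval_pderiv Q t (z 1)).fun_sub ((hasDerivAt_id' t).const_mul a)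
      rw [← hd, ha] at this
      simpa using this
    have := is_const_of_deriv_eq_zero (fun t => (hder t).differentiableAt)
      (fun t => (hder t).deriv) (z 0) 0
    rw [hev]
    rw [← hz] at this
    linear_combination this

/-! ### Exponents permuted by a shift -/

/-- The polynomial `z ↦ Q (z + c)`. -/
noncomputable def shiftBy (c : C2) (Q : MvPolynomial (Fin 2) ℂ) : MvPolynomial (Fin 2) ℂ :=
  MvPolynomial.bind₁ (fun i => MvPolynomial.X i + MvPolynomial.C (c i)) Q

theorem eval_shiftBy (c z : C2) (Q : MvPolynomial (Fin 2) ℂ) :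
    MvPolynomial.eval z (shiftBy c Q) = MvPolynomial.eval (z + c) Q := by
  induction Q using MvPolynomial.induction_on with
  | C a => simp [shiftBy]
  | add p q hp hq => simp only [shiftBy, map_add] at *; rw [hp, hq]
  | mul_X p i hp =>
    simp only [shiftBy, map_mul] at *
    rw [hp]; simp

theorem modConst_eq_of_shiftBy {c : C2} {p q : MvPolynomial (Fin 2) ℂ}
    (h : modConst (shiftBy c p) = modConst (shiftBy c q)) : modConst p = modConst q := by
  obtain ⟨e, he⟩ := exists_eval_eq_add_of_modConst_eq h
  refine modConst_eq_of_eval (c := e) fun z => ?_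
  simpa [eval_shiftBy] using he (z - c)

/-- If `K e^a = N e^b` with a constant `K ≠ 0`, then `a - b` and `N` are constant. -/
theorem exists_const_of_exp_eq {σ : Type*} {K : ℂ} (hK : K ≠ 0) {N a b : MvPolynomial σ ℂ}
    (h : ∀ x : σ → ℂ, K * exp (MvPolynomial.eval x a) =
      MvPolynomial.eval x N * exp (MvPolynomial.eval x b)) :
    ∃ e, (∀ x, MvPolynomial.eval x a = MvPolynomial.eval x b + e) ∧
      N = MvPolynomial.C (K * exp e) := by
  classical
  have hab : modConst a = modConst b := by
    by_contra hab
    have := sum_filter_modConst_eq_zero (Finset.univ : Finset (Fin 2))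
      ![MvPolynomial.C K, -N] ![a, b] (fun x => by
        simp only [Fin.sum_univ_two]
        simp
        linear_combination h x) (modConst a) 0
    simp [Finset.sum_filter, Ne.symm hab, hK] at this
  obtain ⟨e, he⟩ := exists_eval_eq_add_of_modConst_eq hab
  refine ⟨e, he, MvPolynomial.funext fun x => ?_⟩
  have := h x
  rw [he, exp_add] at this
  rw [MvPolynomial.eval_C]
  refine mul_right_cancel₀ (exp_ne_zero (MvPolynomial.eval x b)) ?_
  linear_combination -this

/-- The derivative of `φ` is `h`-periodic, so it takes one value at the infinitely many points `n h`
and is constant. -/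
theorem natDegree_le_one_of_difference_const {φ : Polynomial ℂ} {h C : ℂ} (hh : h ≠ 0)
    (hφ : ∀ x, φ.eval (x + h) = φ.eval x + C) : φ.natDegree ≤ 1 := by
  have hmul (n : ℕ) : (Polynomial.derivative φ).eval (n * h) =
      (Polynomial.derivative φ).eval 0 := by
    have hper (x : ℂ) : (Polynomial.derivative φ).eval (x + h) =
        (Polynomial.derivative φ).eval x := by
      have h1 : HasDerivAt (fun x => φ.eval (x + h)) _ x := (φ.hasDerivAt (x + h)).comp_add_const x h
      have h2 : HasDerivAt (fun x => φ.eval (x + h)) ((Polynomial.derivative φ).eval x) x := by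
        simp_rw [hφ]
        exact (φ.hasDerivAt x).add_const C
      exact h1.unique h2
    induction n with
    | zero => simp
    | succ n ih => rw [← ih, ← hper (n * h)]; congr 1; push_cast; ring
  have hconst : Polynomial.derivative φ =
      Polynomial.C ((Polynomial.derivative φ).eval 0) := by
    refine Polynomial.eq_of_infinite_eval_eq _ _ ?_
    refine (Set.infinite_range_of_injective (f := fun n : ℕ => (n : ℂ) * h) ?_).mono ?_
    · intro m n hmn
      exact_mod_cast mul_right_cancel₀ hh hmn
    · rintro _ ⟨n, rfl⟩
      simpa using hmul n
  have : (Polynomial.derivative φ).natDegree = 0 := by rw [hconst]; simp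
  have h2 := φ.natDegree_derivative
  omega

theorem exists_eval_eq_linear {φ : Polynomial ℂ} (h : φ.natDegree ≤ 1) :
    ∃ β δ : ℂ, ∀ x, φ.eval x = β * x + δ := by
  obtain ⟨β, δ, rfl⟩ := Polynomial.exists_eq_X_add_C_of_natDegree_le_one h
  exact ⟨β, δ, fun x => by simp⟩

/-- If the exponential terms `e^p` and `e^q` are interchanged, up to constants, by
`∂ᵏ/∂z₁ᵏ` followed by a shift, then `p` and `q` have the same linear form and the same periodic
part. -/
theorem linked_exponents {k : ℕ} (hk : 1 ≤ k) {c : C2} {p q : MvPolynomial (Fin 2) ℂ}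
    {K K' M M' : ℂ} (hK : K ≠ 0) (hK' : K' ≠ 0) (hM : M ≠ 0) (hM' : M' ≠ 0)
    (h₁ : ∀ z, K * exp (MvPolynomial.eval z (shiftBy c p)) =
      MvPolynomial.eval z (MvPolynomial.C M * expDeriv q k 1) * exp (MvPolynomial.eval z q))
    (h₂ : ∀ z, K' * exp (MvPolynomial.eval z (shiftBy c q)) =
      MvPolynomial.eval z (MvPolynomial.C M' * expDeriv p k 1) * exp (MvPolynomial.eval z p)) :
    ∃ (a₁ a₂ d d' : ℂ) (Φ : Polynomial ℂ), a₁ ≠ 0 ∧ IsPeriodic Φ (c 1) ∧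
      (c 1 ≠ 0 → Φ.natDegree ≤ 1) ∧
      (∀ z, MvPolynomial.eval z p = linForm a₁ a₂ z + Φ.eval (z 1) + d) ∧
      (∀ z, MvPolynomial.eval z q = linForm a₁ a₂ z + Φ.eval (z 1) + d') ∧
      K * exp (linForm a₁ a₂ c + (d - d')) = M * a₁ ^ k ∧
      K' * exp (linForm a₁ a₂ c - (d - d')) = M' * a₁ ^ k := by
  have hcoef {M m : ℂ} (hM : M ≠ 0) {R : MvPolynomial (Fin 2) ℂ}
      (h : MvPolynomial.C M * R = MvPolynomial.C m) : R = MvPolynomial.C (M⁻¹ * m) := by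
    rw [map_mul, ← h, ← mul_assoc, ← map_mul, inv_mul_cancel₀ hM, map_one, one_mul]
  obtain ⟨e, he, hN⟩ := exists_const_of_exp_eq hK h₁
  obtain ⟨e', he', hN'⟩ := exists_const_of_exp_eq hK' h₂
  obtain ⟨a', b', -, hm', hq⟩ := eq_linear_of_expDeriv_eq_C hk (by simp [hM, hK]) (hcoef hM hN)
  obtain ⟨a, b, ha, hm, hp⟩ := eq_linear_of_expDeriv_eq_C hk (by simp [hM', hK']) (hcoef hM' hN')
  have hb (x y : ℂ) : a * (x + c 0) + b.eval (y + c 1) = a' * x + b'.eval y + e := by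
    have := he ![x, y]
    rw [eval_shiftBy, hp, hq] at this
    simpa using this
  have hb' (x y : ℂ) : a' * (x + c 0) + b'.eval (y + c 1) = a * x + b.eval y + e' := by
    have := he' ![x, y]
    rw [eval_shiftBy, hp, hq] at this
    simpa using this
  obtain rfl : a = a' := by linear_combination hb 1 0 - hb 0 0
  have hKe : K * exp e = M * a ^ k := by rw [← hm']; field_simp
  have hKe' : K' * exp e' = M' * a ^ k := by rw [← hm]; field_simp
  by_cases hc : c 1 = 0
  · have hbe (y : ℂ) : b'.eval y = b.eval y + a * c 0 - e := by
      have := hb 0 y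
      rw [hc, add_zero] at this
      linear_combination -this
    have hee : e' = 2 * (a * c 0) - e := by
      have := hb' 0 0
      rw [hc, add_zero, hbe] at this
      linear_combination -this
    -- With `c₂ = 0` every polynomial in `z₂` is periodic, so all of `b` goes into `Φ`.
    refine ⟨a, 0, 0, a * c 0 - e, b, ha, by simp [IsPeriodic, hc], fun h => absurd hc h,
      fun z => by simp [hp, linForm], fun z => by rw [hq, hbe, linForm]; ring, ?_, ?_⟩
    · rw [← hKe, linForm]; congr 2; ring
    · rw [← hKe', hee, linForm]; congr 2; ring
  -- Going from `p` to `q` and back shifts `b` by `2c₂` and adds only a constant, so `b` is affine;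
  -- it joins the linear form and `Φ = 0`.
  · have hb2 : b.natDegree ≤ 1 := by
      refine natDegree_le_one_of_difference_const (h := 2 * c 1) (C := e + e' - 2 * (a * c 0))
        (by simpa using hc) fun y => ?_
      have h1 := hb 0 (y + c 1)
      have h2 := hb' 0 y
      rw [show y + 2 * c 1 = y + c 1 + c 1 by ring]
      linear_combination h1 + h2
    obtain ⟨β, δ, hβ⟩ := exists_eval_eq_linear hb2
    have hbe (y : ℂ) : b'.eval y = β * y + (β * c 1 + δ + a * c 0 - e) := by
      have := hb 0 y
      rw [hβ] at this
      linear_combination -this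
    have hee : e' = 2 * (a * c 0 + β * c 1) - e := by
      have := hb' 0 0
      rw [hbe, hβ] at this
      linear_combination -this
    refine ⟨a, β, δ, β * c 1 + δ + a * c 0 - e, 0, ha, by simp [IsPeriodic], by simp,
      fun z => by simp [hp, linForm, hβ]; ring, fun z => by rw [hq, hbe, linForm]; simp; ring,
      ?_, ?_⟩
    · rw [← hKe, linForm]; congr 2; ring
    · rw [← hKe', hee, linForm]; congr 2; ring

/-- Four exponential terms cannot be permuted cyclically unless they are proportional. -/
theorem modConst_eq_of_cyclic {k : ℕ} (hk : 1 ≤ k) {c : C2} {p q p' q' : MvPolynomial (Fin 2) ℂ}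
    {K₁ K₂ K₃ K₄ M₁ M₂ M₃ M₄ : ℂ} (hK₁ : K₁ ≠ 0) (hK₂ : K₂ ≠ 0) (hK₃ : K₃ ≠ 0) (hK₄ : K₄ ≠ 0)
    (hM₃ : M₃ ≠ 0) (hM₄ : M₄ ≠ 0)
    (h₁ : ∀ z, K₁ * exp (MvPolynomial.eval z (shiftBy c p)) =
      MvPolynomial.eval z (MvPolynomial.C M₁ * expDeriv p' k 1) * exp (MvPolynomial.eval z p'))
    (h₂ : ∀ z, K₂ * exp (MvPolynomial.eval z (shiftBy c q)) =
      MvPolynomial.eval z (MvPolynomial.C M₂ * expDeriv q' k 1) * exp (MvPolynomial.eval z q'))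
    (h₃ : ∀ z, K₃ * exp (MvPolynomial.eval z (shiftBy c p')) =
      MvPolynomial.eval z (MvPolynomial.C M₃ * expDeriv q k 1) * exp (MvPolynomial.eval z q))
    (h₄ : ∀ z, K₄ * exp (MvPolynomial.eval z (shiftBy c q')) =
      MvPolynomial.eval z (MvPolynomial.C M₄ * expDeriv p k 1) * exp (MvPolynomial.eval z p)) :
    modConst p = modConst q := by
  have hcoef {M m : ℂ} (hM : M ≠ 0) {R : MvPolynomial (Fin 2) ℂ}
      (h : MvPolynomial.C M * R = MvPolynomial.C m) : R = MvPolynomial.C (M⁻¹ * m) := by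
    rw [map_mul, ← h, ← mul_assoc, ← map_mul, inv_mul_cancel₀ hM, map_one, one_mul]
  obtain ⟨e₁, he₁, -⟩ := exists_const_of_exp_eq hK₁ h₁
  obtain ⟨e₂, he₂, -⟩ := exists_const_of_exp_eq hK₂ h₂
  obtain ⟨e₃, he₃, hN₃⟩ := exists_const_of_exp_eq hK₃ h₃
  obtain ⟨e₄, he₄, hN₄⟩ := exists_const_of_exp_eq hK₄ h₄
  obtain ⟨a', b', -, -, hq⟩ :=
    eq_linear_of_expDeriv_eq_C hk (by simp [hM₃, hK₃]) (hcoef hM₃ hN₃)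
  obtain ⟨a, b, -, -, hp⟩ :=
    eq_linear_of_expDeriv_eq_C hk (by simp [hM₄, hK₄]) (hcoef hM₄ hN₄)
  simp only [eval_shiftBy] at he₁ he₂ he₃ he₄
  -- Two steps of the cycle: `p(z + 2c)` is `q(z)` plus a constant.
  have hb (x y : ℂ) : a * (x + 2 * c 0) + b.eval (y + 2 * c 1) =
      a' * x + b'.eval y + (e₁ + e₃) := by
    have h1 := he₁ (![x, y] + c)
    rw [he₃, hp, hq] at h1
    simp only [Pi.add_apply] at h1
    simp at h1
    rw [show y + 2 * c 1 = y + c 1 + c 1 by ring]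
    linear_combination h1
  have hb' (x y : ℂ) : a' * (x + 2 * c 0) + b'.eval (y + 2 * c 1) =
      a * x + b.eval y + (e₂ + e₄) := by
    have h1 := he₂ (![x, y] + c)
    rw [he₄, hp, hq] at h1
    simp only [Pi.add_apply] at h1
    simp at h1
    rw [show y + 2 * c 1 = y + c 1 + c 1 by ring]
    linear_combination h1
  obtain rfl : a = a' := by linear_combination hb 1 0 - hb 0 0
  by_cases hc : c 1 = 0
  · refine modConst_eq_of_eval (c := e₁ + e₃ - 2 * (a * c 0)) fun z => ?_
    have := hb 0 (z 1)
    rw [hc, mul_zero, add_zero] at this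
    rw [hp, hq]
    linear_combination this
  -- The full cycle shifts `b` by `4c₂` up to a constant, so `b` is affine. Then the shift by `2c`
  -- changes `p` only by a constant, and `p - q` is constant.
  · have hb2 : b.natDegree ≤ 1 := by
      refine natDegree_le_one_of_difference_const (h := 4 * c 1)
        (C := e₁ + e₃ + (e₂ + e₄) - 4 * (a * c 0)) (by simpa using hc) fun y => ?_
      have h1 := hb 0 (y + 2 * c 1)
      have h2 := hb' 0 y
      rw [show y + 4 * c 1 = y + 2 * c 1 + 2 * c 1 by ring]
      linear_combination h1 + h2
    obtain ⟨β, δ, hβ⟩ := exists_eval_eq_linear hb2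
    refine modConst_eq_of_eval (c := e₁ + e₃ - 2 * (a * c 0) - 2 * (β * c 1)) fun z => ?_
    have := hb 0 (z 1)
    rw [hβ] at this
    rw [hp, hq, hβ]
    linear_combination this

/-! ### Reduction of the system to exponential identities -/

theorem expDeriv_C (Q : MvPolynomial (Fin 2) ℂ) (k : ℕ) (a : ℂ) :
    expDeriv Q k (MvPolynomial.C a) = MvPolynomial.C a * expDeriv Q k 1 := by
  induction k with
  | zero => simp [expDeriv]
  | succ k ih =>
    simp only [expDeriv, Function.iterate_succ_apply'] at *
    rw [ih, MvPolynomial.pderiv_C_mul]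
    simp only [MvPolynomial.C_eq_smul_one, smul_mul_assoc, one_mul, smul_add]

theorem partialZ1_comp_add_const (k : ℕ) (f : C2 → ℂ) (c z : C2) :
    partialZ1 k (fun z => f (z + c)) z = partialZ1 k f (z + c) := by
  have h : (fun t : ℂ => f (![t, z 1] + c)) = fun t => (fun s : ℂ => f ![s, (z + c) 1]) (t + c 0) := by
    ext t; congr 1; ext i; fin_cases i <;> simp
  simp only [partialZ1]
  rw [h, iteratedDeriv_comp_add_const (f := fun s : ℂ => f ![s, (z + c) 1])]
  rfl

theorem partialZ1_const_mul (k : ℕ) {f : C2 → ℂ} (a : ℂ) :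
    partialZ1 k (fun z => a * f z) = fun z => a * partialZ1 k f z := by
  ext z
  simp only [partialZ1]
  rw [iteratedDeriv_const_mul_field]

/-- Two expressions for `∂ᵏg/∂z₁ᵏ (z + c)`. -/
theorem shifted_exponentials_eq {k : ℕ} {c : C2} {g : C2 → ℂ} {B₁ B₂ D₁ D₂ : ℂ}
    {p q p' q' : MvPolynomial (Fin 2) ℂ}
    (hG : ∀ z, partialZ1 k g z =
      B₁ * exp (MvPolynomial.eval z p') + B₂ * exp (MvPolynomial.eval z q'))
    (hg : ∀ z, g (z + c) = D₁ * exp (MvPolynomial.eval z p) + D₂ * exp (MvPolynomial.eval z q))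
    (z : C2) :
    B₁ * exp (MvPolynomial.eval z (shiftBy c p')) + B₂ * exp (MvPolynomial.eval z (shiftBy c q')) =
      MvPolynomial.eval z (MvPolynomial.C D₁ * expDeriv p k 1) * exp (MvPolynomial.eval z p) +
      MvPolynomial.eval z (MvPolynomial.C D₂ * expDeriv q k 1) * exp (MvPolynomial.eval z q) := by
  rw [eval_shiftBy, eval_shiftBy, ← hG, ← partialZ1_comp_add_const, funext hg, ← expDeriv_C,
    ← expDeriv_C]
  have := congrFun (partialZ1_mul_exp_add k (MvPolynomial.C D₁) p (MvPolynomial.C D₂) q) z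
  simpa only [MvPolynomial.eval_C] using this

theorem sqrtTwo_sq : sqrtTwo ^ 2 = 2 := by
  rw [sqrtTwo, ← ofReal_pow, Real.sq_sqrt zero_le_two, ofReal_ofNat]

theorem sqrtTwo_ne_zero : sqrtTwo ≠ 0 := fun h => by simpa [h] using sqrtTwo_sq

/-- Entire solutions of finite order of `F² + 2wFG + G² = e^{g₁}` are combinations of two
exponentials of polynomials. -/
theorem exists_exponents_of_quadric {w s t : ℂ} (hw1 : w ^ 2 ≠ 1) (hs : s ^ 2 = 1 + w)
    (ht : t ^ 2 = 1 - w) {F G : C2 → ℂ} (hF : Differentiable ℂ F) (hG : Differentiable ℂ G)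
    (hFg : HasFiniteGrowth F) (hGg : HasFiniteGrowth G) {g₁ : MvPolynomial (Fin 2) ℂ}
    (h : ∀ z, F z ^ 2 + 2 * w * F z * G z + G z ^ 2 = exp (MvPolynomial.eval z g₁)) :
    ∃ p q : MvPolynomial (Fin 2) ℂ, p + q = g₁ ∧
      (∀ z, F z = coeffA₁ s t / sqrtTwo * exp (MvPolynomial.eval z p) +
        coeffA₂ s t / sqrtTwo * exp (MvPolynomial.eval z q)) ∧
      (∀ z, G z = coeffA₂ s t / sqrtTwo * exp (MvPolynomial.eval z p) +
        coeffA₁ s t / sqrtTwo * exp (MvPolynomial.eval z q)) := by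
  have hr := sqrtTwo_ne_zero
  have hr2 := sqrtTwo_sq
  have hs0 : s ≠ 0 := by
    rintro rfl
    exact hw1 (by linear_combination (1 - w) * hs)
  have ht0 : t ≠ 0 := by
    rintro rfl
    exact hw1 (by linear_combination (1 + w) * ht)
  set α := (s + I * t) / sqrtTwo with hα
  set β := (s - I * t) / sqrtTwo with hβ
  have hαβ : α * β = 1 := by
    rw [hα, hβ, div_mul_div_comm, div_eq_one_iff_eq (by positivity)]
    linear_combination hs + ht - hr2 - t ^ 2 * I_sq
  have hαβ2 : α ^ 2 + β ^ 2 = 2 * w := by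
    rw [hα, hβ, div_pow, div_pow, ← add_div, hr2, div_eq_iff two_ne_zero]
    linear_combination 2 * hs - 2 * ht + 2 * t ^ 2 * I_sq
  have hprod (z : C2) : (α * F z + β * G z) * (β * F z + α * G z) =
      exp (MvPolynomial.eval z g₁) := by
    rw [← h]
    linear_combination (F z ^ 2 + G z ^ 2) * hαβ + F z * G z * hαβ2
  obtain ⟨p, hp⟩ := exists_exp_mvPolynomial (h := fun z => α * F z + β * G z) (by fun_prop)
    ((hFg.const_mul α).add (hGg.const_mul β)) (fun z hz => by
      have hz' : α * F z + β * G z = 0 := hz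
      exact exp_ne_zero _ (by rw [← hprod z, hz', zero_mul]))
  have hq (z : C2) : β * F z + α * G z = exp (MvPolynomial.eval z (g₁ - p)) := by
    rw [map_sub, exp_sub, ← hp, ← hprod, mul_div_cancel_left₀]
    rw [hp]
    exact exp_ne_zero _
  -- `h1` and `h2` say that the symmetric matrix with entries `A₁/√2`, `A₂/√2` inverts the one with
  -- entries `α`, `β`.
  have h1 : coeffA₁ s t / sqrtTwo * α + coeffA₂ s t / sqrtTwo * β = 1 := by
    rw [coeffA₁, coeffA₂, hα, hβ]
    field_simp
    rw [hr2]; ring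
  have h2 : coeffA₁ s t / sqrtTwo * β + coeffA₂ s t / sqrtTwo * α = 0 := by
    rw [coeffA₁, coeffA₂, hα, hβ]
    field_simp
    ring
  refine ⟨p, g₁ - p, by ring, fun z => ?_, fun z => ?_⟩
  · rw [← hp, ← hq]
    linear_combination -F z * h1 - G z * h2
  · rw [← hp, ← hq]
    linear_combination -G z * h1 - F z * h2

/-- Both follow from `A₁A₂ = 1 / (2s²t²)`. Thus no term on the shifted side of the identities drops
out, as the matching requires. -/
theorem coeff_mul_ne_zero {w s t : ℂ} (hw1 : w ^ 2 ≠ 1) (hs : s ^ 2 = 1 + w)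
    (ht : t ^ 2 = 1 - w) : coeffA₁ s t ≠ 0 ∧ coeffA₂ s t ≠ 0 := by
  have hs0 : s ≠ 0 := by
    rintro rfl
    exact hw1 (by linear_combination (1 - w) * hs)
  have ht0 : t ≠ 0 := by
    rintro rfl
    exact hw1 (by linear_combination (1 + w) * ht)
  have hprod : coeffA₁ s t * coeffA₂ s t * (2 * s ^ 2 * t ^ 2) = 1 := by
    rw [coeffA₁, coeffA₂]
    field_simp
    rw [I_sq]
    linear_combination -hs - ht + t ^ 2 * I_sq
  exact ⟨fun h => by simp [h] at hprod, fun h => by simp [h] at hprod⟩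

/-- Dividing the equations gives `e^{2y} = 1`. The two signs of `e^y`, for each of the two linear
forms, produce subcases (a)–(d). -/
theorem exp_dichotomy {x y m : ℂ} (h₁ : exp (x + y) = m) (h₂ : exp (x - y) = m) :
    (exp x = m ∧ exp y = 1) ∨ (exp x = -m ∧ exp y = -1) := by
  have hy : exp y ^ 2 = 1 := by
    rw [← h₂, exp_add, exp_sub, eq_div_iff (exp_ne_zero y)] at h₁
    refine mul_left_cancel₀ (exp_ne_zero x) ?_
    linear_combination h₁
  rw [exp_add] at h₁
  rcases sq_eq_sq_iff_eq_or_eq_neg.1 (hy.trans (one_pow 2).symm) with h | h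
  · exact Or.inl ⟨by rw [← h₁, h, mul_one], h⟩
  · exact Or.inr ⟨by rw [← h₁, h]; ring, h⟩

theorem eval_sub_periodic {Φ : Polynomial ℂ} {c : C2} (h : IsPeriodic Φ (c 1)) (z : C2) :
    Φ.eval ((z - c) 1) = Φ.eval (z 1) := by
  have := h ((z - c) 1)
  rw [← this]; simp

theorem linForm_sub (a b : ℂ) (z c : C2) : linForm a b (z - c) = linForm a b z - linForm a b c := by
  simp only [linForm, Pi.sub_apply]; ring

/-- When both solutions are single exponentials, the two derivatives vanish simultaneously. -/
theorem coeff_ne_zero_of_single_exponentials {k : ℕ} {c : C2} {f g : C2 → ℂ} {B₁ B₂ D₁ D₂ : ℂ}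
    {G₁ G₂ : MvPolynomial (Fin 2) ℂ} (hD₁ : D₁ ≠ 0)
    (hF : ∀ z, partialZ1 k f z = B₁ * exp (MvPolynomial.eval z G₁))
    (hG : ∀ z, partialZ1 k g z = B₂ * exp (MvPolynomial.eval z G₂))
    (hSg : ∀ z, g (z + c) = D₁ * exp (MvPolynomial.eval z G₁))
    (hSf : ∀ z, f (z + c) = D₂ * exp (MvPolynomial.eval z G₂)) (hD₂ : D₂ ≠ 0)
    (hB₂ : B₂ ≠ 0) : B₁ ≠ 0 := by
  intro hB₁
  have hE := shifted_exponentials_eq (k := k) (c := c) (g := g) (B₁ := B₂) (B₂ := 0) (D₁ := D₁)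
    (D₂ := 0) (p := G₁) (q := 0) (p' := G₂) (q' := 0) (by simpa using hG) (by simpa using hSg)
  obtain ⟨e, he, -⟩ := exists_const_of_exp_eq hB₂
    (N := MvPolynomial.C D₁ * expDeriv G₁ k 1) (a := shiftBy c G₂) (b := G₁)
    (fun z => by simpa using hE z)
  simp only [eval_shiftBy] at he
  -- `g` is a constant multiple of a shift of `f`, so if `∂ᵏf` vanishes then so does `∂ᵏg`.
  have hfg : ∀ z, g z = (D₁ / (D₂ * exp e)) * f (z + c) := by
    intro z
    have h1 := hSf (z - c + c)
    rw [he, exp_add] at h1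
    have h2 := hSg (z - c)
    rw [sub_add_cancel] at h1 h2
    rw [h1, h2]
    have := exp_ne_zero e
    field_simp
  have h0 : partialZ1 k g 0 = 0 := by
    rw [funext hfg, partialZ1_const_mul]
    simp [partialZ1_comp_add_const, hF, hB₁]
  rw [hG] at h0
  exact hB₂ (by simpa using h0)

/-- The case in which both solutions are single exponentials. -/
theorem single_exponential_solution {k : ℕ} (hk : 1 ≤ k) {c : C2} {f g : C2 → ℂ}
    {B₁ B₂ D₁ D₂ : ℂ} {G₁ G₂ : MvPolynomial (Fin 2) ℂ} (hD₁ : D₁ ≠ 0) (hD₂ : D₂ ≠ 0)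
    (hF : ∀ z, partialZ1 k f z = B₁ * exp (MvPolynomial.eval z G₁))
    (hG : ∀ z, partialZ1 k g z = B₂ * exp (MvPolynomial.eval z G₂))
    (hSg : ∀ z, g (z + c) = D₁ * exp (MvPolynomial.eval z G₁))
    (hSf : ∀ z, f (z + c) = D₂ * exp (MvPolynomial.eval z G₂))
    (hnd : (∃ z, partialZ1 k f z ≠ 0) ∨ (∃ z, partialZ1 k g z ≠ 0)) :
    ∃ (a₁ a₂ d d' : ℂ) (Φ : Polynomial ℂ), a₁ ≠ 0 ∧ IsPeriodic Φ (c 1) ∧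
      (c 1 ≠ 0 → Φ.natDegree ≤ 1) ∧ B₁ ≠ 0 ∧ B₂ ≠ 0 ∧
      (∀ z, MvPolynomial.eval z G₁ = linForm a₁ a₂ z + Φ.eval (z 1) + d) ∧
      (∀ z, MvPolynomial.eval z G₂ = linForm a₁ a₂ z + Φ.eval (z 1) + d') ∧
      B₁ * exp (linForm a₁ a₂ c + (d - d')) = D₂ * a₁ ^ k ∧
      B₂ * exp (linForm a₁ a₂ c - (d - d')) = D₁ * a₁ ^ k ∧
      (∀ z, f z = D₂ * exp (linForm a₁ a₂ z + Φ.eval (z 1) - linForm a₁ a₂ c + d')) ∧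
      (∀ z, g z = D₁ * exp (linForm a₁ a₂ z + Φ.eval (z 1) - linForm a₁ a₂ c + d)) := by
  have h12 := coeff_ne_zero_of_single_exponentials hD₁ hF hG hSg hSf hD₂
  have h21 := coeff_ne_zero_of_single_exponentials hD₂ hG hF hSf hSg hD₁
  have hB : B₁ ≠ 0 ∧ B₂ ≠ 0 := by
    rcases hnd with ⟨z, hz⟩ | ⟨z, hz⟩
    · rw [hF] at hz
      exact ⟨left_ne_zero_of_mul hz, h21 (left_ne_zero_of_mul hz)⟩
    · rw [hG] at hz
      exact ⟨h12 (left_ne_zero_of_mul hz), left_ne_zero_of_mul hz⟩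
  -- The two-term identity, with a dummy second term of coefficient 0.
  have hE₁ := shifted_exponentials_eq (k := k) (c := c) (g := f) (B₁ := B₁) (B₂ := 0) (D₁ := D₂)
    (D₂ := 0) (p := G₂) (q := 0) (p' := G₁) (q' := 0) (by simpa using hF) (by simpa using hSf)
  have hE₂ := shifted_exponentials_eq (k := k) (c := c) (g := g) (B₁ := B₂) (B₂ := 0) (D₁ := D₁)
    (D₂ := 0) (p := G₁) (q := 0) (p' := G₂) (q' := 0) (by simpa using hG) (by simpa using hSg)
  obtain ⟨a₁, a₂, d, d', Φ, ha, hper, hdeg, h1, h2, h3, h4⟩ := linked_exponents hk hB.1 hB.2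
    hD₂ hD₁ (p := G₁) (q := G₂) (fun z => by simpa using hE₁ z) (fun z => by simpa using hE₂ z)
  refine ⟨a₁, a₂, d, d', Φ, ha, hper, hdeg, hB.1, hB.2, h1, h2, h3, h4, fun z => ?_, fun z => ?_⟩
  · have := hSf (z - c)
    rw [sub_add_cancel, h2, linForm_sub, eval_sub_periodic hper] at this
    rw [this]; ring_nf
  · have := hSg (z - c)
    rw [sub_add_cancel, h1, linForm_sub, eval_sub_periodic hper] at this
    rw [this]; ring_nf

theorem not_isTranscendental_of_shift_eq_zero {f : C2 → ℂ} {c : C2} (h : ∀ z, f (z + c) = 0) :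
    ¬ IsTranscendental f :=
  fun hf => hf ⟨0, fun z => by simpa using h (z - c)⟩

theorem sign_cases {P P' Q Q' a a' b b' : Prop} (h : (P ∧ a) ∨ (P' ∧ a'))
    (h' : (Q ∧ b) ∨ (Q' ∧ b')) :
    (P ∧ Q ∧ a ∧ b) ∨ (P ∧ Q' ∧ a ∧ b') ∨ (P' ∧ Q ∧ a' ∧ b) ∨ (P' ∧ Q' ∧ a' ∧ b') := by
  rcases h with ⟨hP, ha⟩ | ⟨hP, ha⟩ <;> rcases h' with ⟨hQ, hb⟩ | ⟨hQ, hb⟩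
  · exact Or.inl ⟨hP, hQ, ha, hb⟩
  · exact Or.inr (Or.inl ⟨hP, hQ, ha, hb⟩)
  · exact Or.inr (Or.inr (Or.inl ⟨hP, hQ, ha, hb⟩))
  · exact Or.inr (Or.inr (Or.inr ⟨hP, hQ, ha, hb⟩))

/-- If `p = q + e`, both exponentials are multiples of `e^{(p + q)/2}`, with reciprocal factors `ξ =
e^{e/2}` and `ξ⁻¹`. In the application `p + q` is `g₁` or `g₂`. -/
theorem exp_eq_of_modConst_eq {p q : MvPolynomial (Fin 2) ℂ} (h : modConst p = modConst q) :
    ∃ ξ : ℂ, ξ ≠ 0 ∧ ∀ (a b : ℂ) (z : C2),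
      a * exp (MvPolynomial.eval z p) + b * exp (MvPolynomial.eval z q) =
        (a * ξ + b * ξ⁻¹) * exp (MvPolynomial.eval z (MvPolynomial.C (1 / 2) * (p + q))) := by
  obtain ⟨e, he⟩ := exists_eval_eq_add_of_modConst_eq h
  refine ⟨exp (e / 2), exp_ne_zero _, fun a b z => ?_⟩
  rw [← exp_neg, add_mul, mul_assoc, mul_assoc, ← exp_add, ← exp_add]
  simp only [map_mul, map_add, MvPolynomial.eval_C, he]
  congr 3 <;> ring

/-! ### The classification -/

theorem theorem2 (k : ℕ) (hk : 1 ≤ k) (c : C2) (w : ℂ) (hw0 : w ^ 2 ≠ 0) (hw1 : w ^ 2 ≠ 1)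
    (s t : ℂ) (hs : s ^ 2 = 1 + w) (ht : t ^ 2 = 1 - w)
    (A₁ A₂ : ℂ) (hA₁ : A₁ = coeffA₁ s t) (hA₂ : A₂ = coeffA₂ s t)
    (g₁ g₂ : MvPolynomial (Fin 2) ℂ) (f g : C2 → ℂ)
    (hf : Differentiable ℂ f) (hg : Differentiable ℂ g)
    (hft : IsTranscendental f) (hgt : IsTranscendental g)
    (hfo : FiniteOrder f) (hgo : FiniteOrder g)
    (hsol : IsSolution k c w g₁ g₂ f g)
    (hnd : (∃ z, partialZ1 k f z ≠ 0) ∨ (∃ z, partialZ1 k g z ≠ 0)) :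
    -- case (i)
    (∃ (a₁ a₂ d₁ d₂ ξ₁ ξ₂ : ℂ) (χ : Polynomial ℂ),
      a₁ ≠ 0 ∧ ξ₁ ≠ 0 ∧ ξ₂ ≠ 0 ∧ IsPeriodic χ (c 1) ∧
      (∀ z, MvPolynomial.eval z g₁ = linForm a₁ a₂ z + χ.eval (z 1) + d₁) ∧
      (∀ z, MvPolynomial.eval z g₂ = linForm a₁ a₂ z + χ.eval (z 1) + d₂) ∧
      (∀ z, f z = (A₂ * ξ₂ + A₁ * ξ₂⁻¹) / sqrtTwo *
        exp (1 / 2 * (linForm a₁ a₂ z + χ.eval (z 1) - linForm a₁ a₂ c + d₂))) ∧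
      (∀ z, g z = (A₂ * ξ₁ + A₁ * ξ₁⁻¹) / sqrtTwo *
        exp (1 / 2 * (linForm a₁ a₂ z + χ.eval (z 1) - linForm a₁ a₂ c + d₁))) ∧
      exp (linForm a₁ a₂ c) = (a₁ / 2) ^ (2 * k) *
        (((A₂ * ξ₂ + A₁ * ξ₂⁻¹) * (A₂ * ξ₁ + A₁ * ξ₁⁻¹)) /
          ((A₁ * ξ₁ + A₂ * ξ₁⁻¹) * (A₁ * ξ₂ + A₂ * ξ₂⁻¹))) ∧
      exp (1 / 2 * (linForm a₁ a₂ c + d₁ - d₂)) = (a₁ / 2) ^ k *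
        ((A₂ * ξ₂ + A₁ * ξ₂⁻¹) / (A₁ * ξ₁ + A₂ * ξ₁⁻¹)) ∧
      (c 1 ≠ 0 → χ.natDegree ≤ 1)) ∨
    -- cases (ii) and (iii)
    (∃ (a₁ a₂ b₁ b₂ d₁ d₂ d₃ d₄ : ℂ) (Φ Ψ : Polynomial ℂ),
      IsPeriodic Φ (c 1) ∧ IsPeriodic Ψ (c 1) ∧
      (¬ ∃ C : ℂ, ∀ z : C2,
        (linForm a₁ a₂ z + Φ.eval (z 1)) - (linForm b₁ b₂ z + Ψ.eval (z 1)) = C) ∧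
      (∀ z, MvPolynomial.eval z g₁ = linForm a₁ a₂ z + linForm b₁ b₂ z +
        Φ.eval (z 1) + Ψ.eval (z 1) + d₁ + d₃) ∧
      (∀ z, MvPolynomial.eval z g₂ = linForm a₁ a₂ z + linForm b₁ b₂ z +
        Φ.eval (z 1) + Ψ.eval (z 1) + d₂ + d₄) ∧
      ( -- case (ii)
       ((∀ z, f z =
          (A₂ * exp (linForm b₁ b₂ z + Ψ.eval (z 1) - linForm b₁ b₂ c + d₄) +
            A₁ * exp (linForm a₁ a₂ z + Φ.eval (z 1) - linForm a₁ a₂ c + d₂)) / sqrtTwo) ∧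
        (∀ z, g z =
          (A₂ * exp (linForm a₁ a₂ z + Φ.eval (z 1) - linForm a₁ a₂ c + d₁) +
            A₁ * exp (linForm b₁ b₂ z + Ψ.eval (z 1) - linForm b₁ b₂ c + d₃)) / sqrtTwo) ∧
        ((exp (linForm a₁ a₂ c) = a₁ ^ k ∧ exp (linForm b₁ b₂ c) = b₁ ^ k ∧
            exp (d₁ - d₂) = 1 ∧ exp (d₃ - d₄) = 1) ∨
         (exp (linForm a₁ a₂ c) = a₁ ^ k ∧ exp (linForm b₁ b₂ c) = -b₁ ^ k ∧
            exp (d₁ - d₂) = 1 ∧ exp (d₃ - d₄) = -1) ∨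
         (exp (linForm a₁ a₂ c) = -a₁ ^ k ∧ exp (linForm b₁ b₂ c) = b₁ ^ k ∧
            exp (d₁ - d₂) = -1 ∧ exp (d₃ - d₄) = 1) ∨
         (exp (linForm a₁ a₂ c) = -a₁ ^ k ∧ exp (linForm b₁ b₂ c) = -b₁ ^ k ∧
            exp (d₁ - d₂) = -1 ∧ exp (d₃ - d₄) = -1))) ∨
       -- case (iii)
       ((∀ z, f z =
          (A₂ * exp (linForm a₁ a₂ z + Φ.eval (z 1) - linForm a₁ a₂ c + d₂) +
            A₁ * exp (linForm b₁ b₂ z + Ψ.eval (z 1) - linForm b₁ b₂ c + d₄)) / sqrtTwo) ∧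
        (∀ z, g z =
          (A₂ * exp (linForm a₁ a₂ z + Φ.eval (z 1) - linForm a₁ a₂ c + d₁) +
            A₁ * exp (linForm b₁ b₂ z + Ψ.eval (z 1) - linForm b₁ b₂ c + d₃)) / sqrtTwo) ∧
        ((exp (linForm a₁ a₂ c) = A₂ * a₁ ^ k / A₁ ∧ exp (linForm b₁ b₂ c) = A₁ * b₁ ^ k / A₂ ∧
            exp (d₁ - d₂) = 1 ∧ exp (d₃ - d₄) = 1) ∨
         (exp (linForm a₁ a₂ c) = A₂ * a₁ ^ k / A₁ ∧ exp (linForm b₁ b₂ c) = -(A₁ * b₁ ^ k / A₂) ∧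
            exp (d₁ - d₂) = 1 ∧ exp (d₃ - d₄) = -1) ∨
         (exp (linForm a₁ a₂ c) = -(A₂ * a₁ ^ k / A₁) ∧ exp (linForm b₁ b₂ c) = A₁ * b₁ ^ k / A₂ ∧
            exp (d₁ - d₂) = -1 ∧ exp (d₃ - d₄) = 1) ∨
         (exp (linForm a₁ a₂ c) = -(A₂ * a₁ ^ k / A₁) ∧
            exp (linForm b₁ b₂ c) = -(A₁ * b₁ ^ k / A₂) ∧
            exp (d₁ - d₂) = -1 ∧ exp (d₃ - d₄) = -1))))) := by
  obtain ⟨hA₁0, hA₂0⟩ := coeff_mul_ne_zero hw1 hs ht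
  have hfG := HasFiniteGrowth.of_finiteOrder hf.continuous hfo
  have hgG := HasFiniteGrowth.of_finiteOrder hg.continuous hgo
  obtain ⟨p, q, hpq, hF, hSg⟩ := exists_exponents_of_quadric hw1 hs ht (hf.partialZ1 k)
    (G := fun z => g (z + c)) (by fun_prop) (hfG.partialZ1 hf k) (hgG.comp_add_const c)
    (fun z => (hsol z).1)
  obtain ⟨p', q', hpq', hG, hSf⟩ := exists_exponents_of_quadric hw1 hs ht (hg.partialZ1 k)
    (G := fun z => f (z + c)) (by fun_prop) (hgG.partialZ1 hg k) (hfG.comp_add_const c)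
    (fun z => (hsol z).2)
  rw [← hA₁] at hA₁0
  rw [← hA₂] at hA₂0
  rw [← hA₁, ← hA₂] at hF hSg hG hSf
  have hr := sqrtTwo_ne_zero
  have hA₁r : A₁ / sqrtTwo ≠ 0 := div_ne_zero hA₁0 hr
  have hA₂r : A₂ / sqrtTwo ≠ 0 := div_ne_zero hA₂0 hr
  have hE₁ := shifted_exponentials_eq hF hSf
  have hE₂ := shifted_exponentials_eq hG hSg
  have hne : modConst p ≠ modConst q ↔ modConst p' ≠ modConst q' := by
    constructor
    · intro h
      exact (exp_pair_matching hA₁r hA₂r (mt modConst_eq_of_shiftBy h) hE₁).1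
    · intro h
      exact (exp_pair_matching hA₁r hA₂r (mt modConst_eq_of_shiftBy h) hE₂).1
  by_cases hpq_eq : modConst p = modConst q
  · left
    have hpq_eq' : modConst p' = modConst q' := by
      by_contra h
      exact hne.2 h hpq_eq
    obtain ⟨ξ₁, hξ₁, h₁⟩ := exp_eq_of_modConst_eq hpq_eq
    obtain ⟨ξ₂, hξ₂, h₂⟩ := exp_eq_of_modConst_eq hpq_eq'
    rw [hpq] at h₁
    rw [hpq'] at h₂
    simp only [h₁] at hF hSg
    simp only [h₂] at hG hSf
    have hD₁ : A₂ / sqrtTwo * ξ₁ + A₁ / sqrtTwo * ξ₁⁻¹ ≠ 0 := fun h =>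
      not_isTranscendental_of_shift_eq_zero (fun z => by rw [hSg, h, zero_mul]) hgt
    have hD₂ : A₂ / sqrtTwo * ξ₂ + A₁ / sqrtTwo * ξ₂⁻¹ ≠ 0 := fun h =>
      not_isTranscendental_of_shift_eq_zero (fun z => by rw [hSf, h, zero_mul]) hft
    obtain ⟨a₁, a₂, d, d', Φ, ha, hper, hdeg, hB₁, hB₂, hG₁, hG₂, hc₁, hc₂, hfz, hgz⟩ :=
      single_exponential_solution hk hD₁ hD₂ hF hG hSg hSf hnd
    have hdiv (a b ξ : ℂ) : a / sqrtTwo * ξ + b / sqrtTwo * ξ⁻¹ = (a * ξ + b * ξ⁻¹) / sqrtTwo := by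
      ring
    rw [hdiv] at hc₁ hc₂ hB₁ hB₂ hD₁ hD₂
    rw [hdiv] at hc₁ hc₂
    simp only [hdiv] at hfz hgz
    have hlin (z : C2) : linForm (2 * a₁) (2 * a₂) z = 2 * linForm a₁ a₂ z := by
      simp only [linForm]; ring
    set X₁ := A₁ * ξ₁ + A₂ * ξ₁⁻¹
    set X₂ := A₁ * ξ₂ + A₂ * ξ₂⁻¹
    set Y₁ := A₂ * ξ₁ + A₁ * ξ₁⁻¹
    set Y₂ := A₂ * ξ₂ + A₁ * ξ₂⁻¹
    have hX₁ : X₁ ≠ 0 := (div_ne_zero_iff.1 hB₁).1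
    have hX₂ : X₂ ≠ 0 := (div_ne_zero_iff.1 hB₂).1
    have hc₁' : X₁ * exp (linForm a₁ a₂ c + (d - d')) = Y₂ * a₁ ^ k := by
      field_simp at hc₁
      linear_combination hc₁
    have hc₂' : X₂ * exp (linForm a₁ a₂ c - (d - d')) = Y₁ * a₁ ^ k := by
      field_simp at hc₂
      linear_combination hc₂
    -- The data found describe `g₁/2` and `g₂/2`, hence the doubling.
    refine ⟨2 * a₁, 2 * a₂, 2 * d, 2 * d', ξ₁, ξ₂, Polynomial.C 2 * Φ, by simpa using ha, hξ₁, hξ₂,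
      fun x => by simp [hper x], fun z => ?_, fun z => ?_, fun z => ?_, fun z => ?_, ?_, ?_,
      fun h => (Polynomial.natDegree_C_mul_le _ _).trans (hdeg h)⟩
    · have := hG₁ z
      simp only [map_mul, MvPolynomial.eval_C] at this
      rw [hlin, Polynomial.eval_mul, Polynomial.eval_C]
      linear_combination 2 * this
    · have := hG₂ z
      simp only [map_mul, MvPolynomial.eval_C] at this
      rw [hlin, Polynomial.eval_mul, Polynomial.eval_C]
      linear_combination 2 * this
    · rw [hfz, hlin, hlin, Polynomial.eval_mul, Polynomial.eval_C]
      congr 2; ring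
    · rw [hgz, hlin, hlin, Polynomial.eval_mul, Polynomial.eval_C]
      congr 2; ring
    -- Multiplying `hc₁'` by `hc₂'` eliminates `d - d'`.
    · rw [hlin, mul_div_cancel_left₀ _ two_ne_zero, mul_div_assoc', eq_div_iff (mul_ne_zero hX₁ hX₂),
        show 2 * linForm a₁ a₂ c = (linForm a₁ a₂ c + (d - d')) + (linForm a₁ a₂ c - (d - d')) by
          ring, exp_add, two_mul, pow_add]
      linear_combination (X₂ * exp (linForm a₁ a₂ c - (d - d'))) * hc₁' + (Y₂ * a₁ ^ k) * hc₂'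
    · rw [hlin, mul_div_cancel_left₀ _ two_ne_zero, mul_div_assoc', eq_div_iff hX₁,
        show 1 / 2 * (2 * linForm a₁ a₂ c + 2 * d - 2 * d') = linForm a₁ a₂ c + (d - d') by ring]
      linear_combination hc₁'
  · right
    have hpq_ne' := hne.1 hpq_eq
    obtain ⟨-, hm₁⟩ := exp_pair_matching hA₁r hA₂r (mt modConst_eq_of_shiftBy hpq_eq) hE₁
    obtain ⟨-, hm₂⟩ := exp_pair_matching hA₁r hA₂r (mt modConst_eq_of_shiftBy hpq_ne') hE₂
    have hfz (z : C2) := hSf (z - c)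
    have hgz (z : C2) := hSg (z - c)
    simp only [sub_add_cancel] at hfz hgz
    have hsep {a₁ a₂ b₁ b₂ d₁ d₃ : ℂ} {Φ Ψ : Polynomial ℂ}
        (hp : ∀ z, MvPolynomial.eval z p = linForm a₁ a₂ z + Φ.eval (z 1) + d₁)
        (hq : ∀ z, MvPolynomial.eval z q = linForm b₁ b₂ z + Ψ.eval (z 1) + d₃) :
        ¬ ∃ C : ℂ, ∀ z : C2,
          (linForm a₁ a₂ z + Φ.eval (z 1)) - (linForm b₁ b₂ z + Ψ.eval (z 1)) = C := by
      rintro ⟨C, hC⟩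
      refine hpq_eq (modConst_eq_of_eval (c := C + d₁ - d₃) fun z => ?_)
      rw [hp, hq]
      linear_combination hC z
    have hsolve {X Y x m : ℂ} (hX : X / sqrtTwo ≠ 0) (h : X / sqrtTwo * x = Y / sqrtTwo * m) :
        x = Y * m / X := by
      have hX' := (div_ne_zero_iff.1 hX).1
      field_simp at h ⊢
      linear_combination h
    rcases hm₁ with ⟨-, -, h₁, h₂⟩ | ⟨-, -, h₁, h₂⟩ <;>
      rcases hm₂ with ⟨-, -, h₃, h₄⟩ | ⟨-, -, h₃, h₄⟩
    -- Both straight: `p` is linked with `p'` and `q` with `q'`. The coefficients on the two sides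
    -- differ, whence the ratios `A₂/A₁` and `A₁/A₂` of case (iii).
    · obtain ⟨a₁, a₂, d₁, d₂, Φ, -, hΦ, -, hp, hp', hc₁, hc₂⟩ :=
        linked_exponents hk hA₁r hA₁r hA₂r hA₂r h₁ h₃
      obtain ⟨b₁, b₂, d₃, d₄, Ψ, -, hΨ, -, hq, hq', hc₃, hc₄⟩ :=
        linked_exponents hk hA₂r hA₂r hA₁r hA₁r h₂ h₄
      refine ⟨a₁, a₂, b₁, b₂, d₁, d₂, d₃, d₄, Φ, Ψ, hΦ, hΨ, hsep hp hq,
        fun z => by rw [← hpq, map_add, hp, hq]; ring,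
        fun z => by rw [← hpq', map_add, hp', hq']; ring,
        Or.inr ⟨fun z => ?_, fun z => ?_, ?_⟩⟩
      · rw [hfz, hp', hq', linForm_sub, linForm_sub, eval_sub_periodic hΦ, eval_sub_periodic hΨ]
        ring_nf
      · rw [hgz, hp, hq, linForm_sub, linForm_sub, eval_sub_periodic hΦ, eval_sub_periodic hΨ]
        ring_nf
      · exact sign_cases (exp_dichotomy (hsolve hA₁r hc₁) (hsolve hA₁r hc₂))
          (exp_dichotomy (hsolve hA₂r hc₃) (hsolve hA₂r hc₄))
    · exact absurd (modConst_eq_of_cyclic hk hA₁r hA₂r hA₁r hA₂r hA₁r hA₂r h₁ h₂ h₃ h₄) hpq_eq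
    · exact absurd (modConst_eq_of_cyclic hk hA₁r hA₂r hA₂r hA₁r hA₁r hA₂r h₁ h₂ h₄ h₃) hpq_eq
    -- Both crossed: `p` is linked with `q'` and `q` with `p'`. Equal coefficients cancel, giving
    -- case (ii).
    · obtain ⟨a₁, a₂, d₁, d₂, Φ, -, hΦ, -, hp, hq', hc₁, hc₂⟩ :=
        linked_exponents hk hA₁r hA₂r hA₁r hA₂r h₁ h₄
      obtain ⟨b₁, b₂, d₃, d₄, Ψ, -, hΨ, -, hq, hp', hc₃, hc₄⟩ :=
        linked_exponents hk hA₂r hA₁r hA₂r hA₁r h₂ h₃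
      refine ⟨a₁, a₂, b₁, b₂, d₁, d₂, d₃, d₄, Φ, Ψ, hΦ, hΨ, hsep hp hq,
        fun z => by rw [← hpq, map_add, hp, hq]; ring,
        fun z => by rw [← hpq', map_add, hp', hq']; ring,
        Or.inl ⟨fun z => ?_, fun z => ?_, ?_⟩⟩
      · rw [hfz, hp', hq', linForm_sub, linForm_sub, eval_sub_periodic hΦ, eval_sub_periodic hΨ]
        ring_nf
      · rw [hgz, hp, hq, linForm_sub, linForm_sub, eval_sub_periodic hΦ, eval_sub_periodic hΨ]
        ring_nf
      · exact sign_cases (exp_dichotomy (mul_left_cancel₀ hA₁r hc₁) (mul_left_cancel₀ hA₂r hc₂))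
          (exp_dichotomy (mul_left_cancel₀ hA₂r hc₃) (mul_left_cancel₀ hA₁r hc₄))
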